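/- Consider the class of dissipative shallow-water systems \[ u_t+uu_x+h_x-F(h,u_x,h_x)\,u_{xx}=0,\qquad h_t+uh_x+hu_x=0 \] for $u(t,x)$ and $h(t,x)$, where the arbitrary element $F$ runs through the smooth real functions of $(h,u_x,h_x)$ on nonempty open subsets of $\mathbb R^3$; the result holds both without further restriction on $F$ and under the constitutive inequality $F\neq0$ (i.e. for nowhere vanishing $F$). An equivalence transformation of the class is a (local) point transformation of the space with coordinates $(t,x,u,h)$, the derivatives of $u,h$ up to order two, and $F$, that is projectable on the spaces of $(t,x,u,h)$ and of its derivatives (its projection to the derivatives being the prolongation of a local diffeomorphism of the space of $(t,x,u,h)$), that maps every arbitrary element $F$ of the class to an arbitrary element $F'$ of the class, and whose projection maps the system with $F$ to the system with $F'$. Transformations are considered over a domain (nonempty connected open set) $U$ of values of $(t,x,u,h)$ and a nonempty open set $W\subseteq\mathbb R$ of values of $F$, at all derivatives at which the prolongation is defined. The equivalence algebra $\mathfrak g^\sim$ consists of the smooth vector fields that generate local one-parameter groups of equivalence transformations; it is written through components along $\partial_t,\partial_x,\partial_u,\partial_h,\partial_F$, the first four depending on $(t,x,u,h)$ only and the last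 one a priori on all variables. \textbf{Theorem.} The equivalence algebra $\mathfrak g^\sim$ has the basis \[ \partial_t,\quad \partial_x,\quad t\partial_x+\partial_u,\quad t\partial_t-u\partial_u-2h\partial_h-F\partial_F,\quad x\partial_x+u\partial_u+2h\partial_h+2F\partial_F , \] that is, these five vector fields are linearly independent and, over any $U$ and $W$ as above, a vector field belongs to the equivalence algebra if and only if it is the restriction of a real linear combination of them. Besides the continuous equivalence transformations generated by these fields, the class admits two discrete equivalence transformations, \[ (t,x,u,h,F)\mapsto(-t,-x,u,h,-F),\qquad (t,x,u,h,F)\mapsto(-t,x,-u,h,-F), \] which are independent modulo the continuous ones (neither of them, nor their product, belongs to the group generated by the continuous transformations). The continuous and the discrete transformations together generate the whole equivalence group $G^\sim$: over any $U$ and $W$ as above, a transformation is an equivalence transformation if and only if it is the restriction of an element of the group of transformations of the space of $(t,x,u,h,F)$ generated by the flows of the linear combinations of the five fields and by the two discrete transformations. -/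

import Mathlib

open scoped ContDiff

noncomputable section

namespace ShallowWater

/-- The space of the independent and dependent variables, with coordinates `(t, x, u, h)`. -/
abbrev Base : Type := Fin 4 → ℝ

/-- The space of `(t, x)` and the derivatives of `(u, h)` up to order two, with coordinates
`0: t, 1: x, 2: u, 3: h, 4: u_t, 5: u_x, 6: h_t, 7: h_x,
8: u_tt, 9: u_tx, 10: u_xx, 11: h_tt, 12: h_tx, 13: h_xx`. -/
abbrev Jet : Type := Fin 14 → ℝ

/-- The jet space extended by one coordinate for the value of the arbitrary element `F`. -/
abbrev ExtJet : Type := Jet × ℝ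

/-- The space with coordinates `((t, x, u, h), F)`. -/
abbrev Total : Type := Base × ℝ

/-- The projection of the jet space onto the space of `(t, x, u, h)`. -/
def toBase (j : Jet) : Base := ![j 0, j 1, j 2, j 3]

/-- The projection of the extended jet space onto the space of `(t, x, u, h, F)`. -/
def toTotal (m : ExtJet) : Total := (toBase m.1, m.2)

/-- The arguments `(h, u_x, h_x)` of the arbitrary element. -/
def args (j : Jet) : Fin 3 → ℝ := ![j 3, j 5, j 7]

/-! ### The class of dissipative shallow-water equations -/

/-- An arbitrary element of the class: a smooth real function `F = F(h, u_x, h_x)` on a nonempty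
open set `dom`. -/
structure ArbElem where
  dom : Set (Fin 3 → ℝ)
  toFun : (Fin 3 → ℝ) → ℝ
  isOpen_dom : IsOpen dom
  nonempty_dom : dom.Nonempty
  smooth : ContDiffOn ℝ ∞ toFun dom

/-- All arbitrary elements. -/
def allElements : Set ArbElem := Set.univ

/-- The arbitrary elements satisfying the constitutive inequality `F ≠ 0`. -/
def nonvanishingElements : Set ArbElem := {θ | ∀ y ∈ θ.dom, θ.toFun y ≠ 0}

/-- The system with arbitrary element `F`, as a subset of the jet space:
`u_t + u u_x + h_x - F(h, u_x, h_x) u_xx = 0` and `h_t + u h_x + h u_x = 0`. -/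
def system (θ : ArbElem) : Set Jet :=
  {j | args j ∈ θ.dom ∧
    j 4 + j 2 * j 5 + j 7 - θ.toFun (args j) * j 10 = 0 ∧
    j 6 + j 2 * j 7 + j 3 * j 5 = 0}

/-- The graph of an arbitrary element in the extended jet space. -/
def graph (θ : ArbElem) : Set ExtJet :=
  {m | args m.1 ∈ θ.dom ∧ m.2 = θ.toFun (args m.1)}

/-! ### Prolongation of point transformations -/

/-- The total derivative `D_t`, for functions of the jet variables of order at most one. -/
def totalT (A : Jet → ℝ) (j : Jet) : ℝ :=
  fderiv ℝ A j ![1, 0, j 4, j 6, j 8, j 9, j 11, j 12, 0, 0, 0, 0, 0, 0]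

/-- The total derivative `D_x`, for functions of the jet variables of order at most one. -/
def totalX (A : Jet → ℝ) (j : Jet) : ℝ :=
  fderiv ℝ A j ![0, 1, j 5, j 7, j 9, j 10, j 12, j 13, 0, 0, 0, 0, 0, 0]

/-- The `i`-th component of a transformation of `(t, x, u, h)`, as a function on jets. -/
def comp (g : Base → Base) (i : Fin 4) (j : Jet) : ℝ := g (toBase j) i

/-- The Jacobian determinant `D_t t' D_x x' - D_x t' D_t x'` of the new independent variables. -/
def jac (g : Base → Base) (j : Jet) : ℝ :=
  totalT (comp g 0) j * totalX (comp g 1) j - totalX (comp g 0) j * totalT (comp g 1) j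

/-- The total derivative with respect to the new variable `t'`, where
`D_t = (D_t t') D_t' + (D_t x') D_x'` and `D_x = (D_x t') D_t' + (D_x x') D_x'`. -/
def newT (g : Base → Base) (A : Jet → ℝ) (j : Jet) : ℝ :=
  (totalX (comp g 1) j * totalT A j - totalT (comp g 1) j * totalX A j) / jac g j

/-- The total derivative with respect to the new variable `x'`. -/
def newX (g : Base → Base) (A : Jet → ℝ) (j : Jet) : ℝ :=
  (totalT (comp g 0) j * totalX A j - totalX (comp g 0) j * totalT A j) / jac g j

/-- The second prolongation of the point transformation `(t', x', u', h') = g(t, x, u, h)`,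
defined at the jets at which `jac g` does not vanish. -/
def prolong (g : Base → Base) (j : Jet) : Jet :=
  let u := comp g 2
  let h := comp g 3
  ![comp g 0 j, comp g 1 j, u j, h j,
    newT g u j, newX g u j, newT g h j, newX g h j,
    newT g (newT g u) j, newX g (newT g u) j, newX g (newX g u) j,
    newT g (newT g h) j, newX g (newT g h) j, newX g (newX g h) j]

/-- A transformation of the extended jet space that is projectable on the spaces of
`(t, x, u, h)` and of its derivatives: the variables `(t, x, u, h)` are transformed by `base`, the
derivatives by prolongation of `base`, and the value of `F` by a function `arb` of all variables. -/
structure Transf where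
  base : Base → Base
  arb : ExtJet → ℝ

/-- The action of a transformation on the extended jet space. -/
def Transf.act (φ : Transf) (m : ExtJet) : ExtJet := (prolong φ.base m.1, φ.arb m)

/-- The part of the extended jet space over a set `U` of values of `(t, x, u, h)` and a set `W` of
values of `F`. -/
def cylinder (U : Set Base) (W : Set ℝ) : Set ExtJet := {m | toBase m.1 ∈ U ∧ m.2 ∈ W}

/-- The part of `cylinder U W` on which the prolonged transformation is defined. -/
def Transf.domain (φ : Transf) (U : Set Base) (W : Set ℝ) : Set ExtJet :=
  {m ∈ cylinder U W | jac φ.base m.1 ≠ 0}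

/-! ### Equivalence transformations and the equivalence algebra -/

/-- A (local) equivalence transformation, over the open sets `U` and `W`, of the class with set of
arbitrary elements `S`: a local diffeomorphism which maps every arbitrary element
`θ` in `S` to some `θ'` in `S` and the system with `θ` to the system with `θ'`. -/
structure IsEquivalenceTransformation (S : Set ArbElem) (U : Set Base) (W : Set ℝ)
    (φ : Transf) : Prop where
  smooth_base : ContDiffOn ℝ ∞ φ.base U
  injOn_base : Set.InjOn φ.base U
  bijective_base : ∀ z ∈ U, Function.Bijective (fderiv ℝ φ.base z)
  smooth_arb : ContDiffOn ℝ ∞ φ.arb (φ.domain U W)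
  injOn_act : Set.InjOn φ.act (φ.domain U W)
  deriv_arb : ∀ m ∈ φ.domain U W, fderiv ℝ φ.arb m (0, 1) ≠ 0
  maps_class : ∀ θ ∈ S, ∃ θ' ∈ S,
    φ.act '' (graph θ ∩ φ.domain U W) = graph θ' ∩ φ.act '' φ.domain U W ∧
    ∀ m ∈ graph θ ∩ φ.domain U W, m.1 ∈ system θ ↔ prolong φ.base m.1 ∈ system θ'

/-- `Q = τ ∂_t + ξ ∂_x + η ∂_u + χ ∂_h + ω ∂_F`, given by its coefficients `((τ, ξ, η, χ), ω)` as
functions on the extended jet space over `U` and `W`, belongs to the equivalence algebra: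
`(τ, ξ, η, χ)` depend on `(t, x, u, h)` only, and near every point `Q` generates a local
one-parameter group of equivalence transformations `φ s`. -/
structure IsInfinitesimalEquivalence (S : Set ArbElem) (U : Set Base) (W : Set ℝ)
    (Q : ExtJet → Total) : Prop where
  smooth : ContDiffOn ℝ ∞ Q (cylinder U W)
  projectable : ∃ Q₀ : Base → Base, ∀ m ∈ cylinder U W, (Q m).1 = Q₀ (toBase m.1)
  generates : ∀ z ∈ U, ∀ c ∈ W, ∃ U₁ ⊆ U, ∃ W₁ ⊆ W, ∃ ε > 0, ∃ φ : ℝ → Transf,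
    IsOpen U₁ ∧ IsConnected U₁ ∧ z ∈ U₁ ∧ IsOpen W₁ ∧ c ∈ W₁ ∧
    (∀ s, |s| < ε → IsEquivalenceTransformation S U₁ W₁ (φ s)) ∧
    ContDiffOn ℝ ∞ (fun p : ℝ × Base => (φ p.1).base p.2) {p | |p.1| < ε ∧ p.2 ∈ U₁} ∧
    ContDiffOn ℝ ∞ (fun p : ℝ × ExtJet => (φ p.1).arb p.2)
      {p | |p.1| < ε ∧ p.2 ∈ (φ p.1).domain U₁ W₁} ∧
    (∀ z' ∈ U₁, (φ 0).base z' = z') ∧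
    (∀ m ∈ cylinder U₁ W₁, (φ 0).arb m = m.2) ∧
    ∀ s, |s| < ε → ∀ m ∈ (φ s).domain U₁ W₁,
      (φ s).act m ∈ cylinder U W ∧
      HasDerivAt (fun r => (((φ r).base (toBase m.1), (φ r).arb m) : Total))
        (Q ((φ s).act m)) s

/-- The vector fields `∂_t`, `∂_x`, `t ∂_x + ∂_u`, `t ∂_t - u ∂_u - 2h ∂_h - F ∂_F` and
`x ∂_x + u ∂_u + 2h ∂_h + 2F ∂_F` on the space of `(t, x, u, h, F)`. -/
def basisField : Fin 5 → Total → Total :=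
  ![fun _ => (![1, 0, 0, 0], 0),
    fun _ => (![0, 1, 0, 0], 0),
    fun y => (![0, y.1 0, 1, 0], 0),
    fun y => (![y.1 0, 0, -y.1 2, -2 * y.1 3], -y.2),
    fun y => (![0, y.1 1, y.1 2, 2 * y.1 3], 2 * y.2)]

/-- The linear span of the five vector fields. -/
def fieldSpan : Submodule ℝ (Total → Total) := Submodule.span ℝ (Set.range basisField)

/-- `σ` is the time-one map of the flow of the vector field `v`. -/
def IsTimeOneMap (v : Total → Total) (σ : Equiv.Perm Total) : Prop :=
  ∀ y, ∃ γ : ℝ → Total, γ 0 = y ∧ (∀ s, HasDerivAt γ (v (γ s)) s) ∧ γ 1 = σ y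

/-- The group generated by the one-parameter groups of the fields in `fieldSpan`. -/
def continuousGroup : Subgroup (Equiv.Perm Total) :=
  Subgroup.closure {σ | ∃ v ∈ fieldSpan, IsTimeOneMap v σ}

/-- The transformation `(t, x, u, h, F) ↦ (-t, -x, u, h, -F)`. -/
def discrete₁ : Equiv.Perm Total :=
  Function.Involutive.toPerm (fun y => (![-y.1 0, -y.1 1, y.1 2, y.1 3], -y.2)) (by
    intro y
    refine Prod.ext ?_ (by simp)
    funext i
    fin_cases i <;> simp)

/-- The transformation `(t, x, u, h, F) ↦ (-t, x, -u, h, -F)`. -/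
def discrete₂ : Equiv.Perm Total :=
  Function.Involutive.toPerm (fun y => (![-y.1 0, y.1 1, -y.1 2, y.1 3], -y.2)) (by
    intro y
    refine Prod.ext ?_ (by simp)
    funext i
    fin_cases i <;> simp)

/-- The group generated by the continuous transformations and the two discrete ones. -/
def generatedGroup : Subgroup (Equiv.Perm Total) :=
  continuousGroup ⊔ Subgroup.closure {discrete₁, discrete₂}

end ShallowWater

end

noncomputable section

namespace ShallowWater

open Filter Topology

/-! The core fact is that over any `U` and `W` the equivalence transformations are exactly the
similarities: shifts of t and x, Galilean boosts and two independent nonzero scalings τ, b. A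
similarity multiplies the two equations by b/τ and b²/τ once F is rescaled by τb², so it is an
equivalence transformation (`isEquivalenceTransformation_of_similarity`).

The converse (`exists_similarity`) needs only constant arbitrary elements c ≠ 0, which belong to
both versions of the class. A constant on the complement of a point shows that the new (h, u_x, h_x)
determine the old ones, which forces t' to depend on t alone (`grad_time`). A constant on all of ℝ³
sends every solution jet to a solution jet, and the free jet variables can then be split off. Mass
conservation removes u from x' and h' (`grad_velocity`). Since h_xx is absent from the system, x'
and u' do not involve h (`grad_height`). The coefficient of u_xx gives F' = F (x'_x)²/t'_t, and what
remains is a first-order system for the four components (`first_order`). Differentiating it shows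
that t'_t, x'_x and x'_t are constant (`second_order`), and integration yields a similarity.

For the group, time-one flows give precisely the similarities with τ, b > 0, and the two discrete
transformations supply the other signs. For the algebra, a local one-parameter group of equivalence
transformations is a curve of similarities, so its velocity at the identity lies in the span; the
local combinations agree on overlaps and glue over the connected `U`. Conversely, the explicit flows
consist of similarities. -/

/-- The transformation `t' = τ t + t₀`, `x' = τ b x + τ k t + x₀`, `u' = b u + k`, `h' = b² h`,
`F' = τ b² F`. -/
def similarity (τ b k t₀ x₀ : ℝ) (y : Total) : Total :=
  (![τ * y.1 0 + t₀, τ * b * y.1 1 + τ * k * y.1 0 + x₀, b * y.1 2 + k, b ^ 2 * y.1 3],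
    τ * b ^ 2 * y.2)

/-! ### The group law of similarities -/

theorem total_ext {y y' : Total} (h0 : y.1 0 = y'.1 0) (h1 : y.1 1 = y'.1 1)
    (h2 : y.1 2 = y'.1 2) (h3 : y.1 3 = y'.1 3) (h4 : y.2 = y'.2) : y = y' := by
  refine Prod.ext (funext fun i => ?_) h4
  fin_cases i <;> assumption

theorem similarity_comp (τ b k t₀ x₀ τ' b' k' t₀' x₀' : ℝ) (y : Total) :
    similarity τ b k t₀ x₀ (similarity τ' b' k' t₀' x₀' y) =
      similarity (τ * τ') (b * b') (b * k' + k) (τ * t₀' + t₀)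
        (τ * b * x₀' + τ * k * t₀' + x₀) y := by
  apply total_ext <;> simp [similarity] <;> ring

theorem similarity_one (y : Total) : similarity 1 1 0 0 0 y = y := by
  apply total_ext <;> simp [similarity]

theorem similarity_inv_comp {τ b : ℝ} (hτ : τ ≠ 0) (hb : b ≠ 0) (k t₀ x₀ : ℝ) (y : Total) :
    similarity τ⁻¹ b⁻¹ (-k / b) (-t₀ / τ) ((k * t₀ - x₀) / (τ * b))
      (similarity τ b k t₀ x₀ y) = y := by
  rw [similarity_comp]
  convert similarity_one y using 2 <;> field_simp <;> ring

/-- The similarities whose scaling factors `τ` and `b` belong to `H`. -/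
def similarityGroup (H : Subgroup ℝˣ) : Subgroup (Equiv.Perm Total) where
  carrier := {σ | ∃ τ ∈ H, ∃ b ∈ H, ∃ k t₀ x₀ : ℝ, ∀ y, σ y = similarity τ b k t₀ x₀ y}
  mul_mem' := by
    rintro σ σ' ⟨τ, hτ, b, hb, k, t₀, x₀, h⟩ ⟨τ', hτ', b', hb', k', t₀', x₀', h'⟩
    refine ⟨τ * τ', H.mul_mem hτ hτ', b * b', H.mul_mem hb hb', b * k' + k, τ * t₀' + t₀,
      τ * b * x₀' + τ * k * t₀' + x₀, fun y => ?_⟩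
    rw [Equiv.Perm.mul_apply, h', h, similarity_comp]
    simp
  one_mem' := ⟨1, H.one_mem, 1, H.one_mem, 0, 0, 0, fun y => by simp [similarity_one]⟩
  inv_mem' := by
    rintro σ ⟨τ, hτ, b, hb, k, t₀, x₀, h⟩
    refine ⟨τ⁻¹, H.inv_mem hτ, b⁻¹, H.inv_mem hb, -k / b, -t₀ / τ, (k * t₀ - x₀) / (τ * b),
      fun y => ?_⟩
    have := similarity_inv_comp τ.ne_zero b.ne_zero k t₀ x₀ (σ⁻¹ y)
    rw [← h, show σ (σ⁻¹ y) = y from σ.apply_symm_apply y] at this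
    simpa using this.symm

/-- The permutation of the total space given by a similarity. -/
def similarityPerm {τ b : ℝ} (hτ : τ ≠ 0) (hb : b ≠ 0) (k t₀ x₀ : ℝ) : Equiv.Perm Total where
  toFun := similarity τ b k t₀ x₀
  invFun := similarity τ⁻¹ b⁻¹ (-k / b) (-t₀ / τ) ((k * t₀ - x₀) / (τ * b))
  left_inv := similarity_inv_comp hτ hb k t₀ x₀
  right_inv y := by
    rw [similarity_comp]
    convert similarity_one y using 2 <;> field_simp <;> ring

/-! ### Flows of the fields -/

/-- The linear combination of the fields `basisField` with coefficients `c`. -/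
def field (c : Fin 5 → ℝ) (y : Total) : Total :=
  (![c 0 + c 3 * y.1 0, c 1 + c 2 * y.1 0 + c 4 * y.1 1, c 2 + (c 4 - c 3) * y.1 2,
    2 * (c 4 - c 3) * y.1 3], (2 * c 4 - c 3) * y.2)

theorem sum_smul_basisField (c : Fin 5 → ℝ) : ∑ i, c i • basisField i = field c := by
  funext y
  apply total_ext <;> simp [basisField, field, Fin.sum_univ_five] <;> ring

theorem mem_fieldSpan_iff {v : Total → Total} : v ∈ fieldSpan ↔ ∃ c, v = field c := by
  rw [fieldSpan, Submodule.mem_span_range_iff_exists_fun]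
  simp only [sum_smul_basisField, eq_comm]

theorem linearIndependent_basisField : LinearIndependent ℝ basisField := by
  rw [Fintype.linearIndependent_iff]
  intro c hc
  rw [sum_smul_basisField] at hc
  -- The origin isolates the coefficients of the shifts and the boost; the all-ones point then gives
  -- those of the scalings.
  have h0 := congrFun hc (0, 0)
  have h1 := congrFun hc (![1, 1, 1, 1], 1)
  simp only [field, Prod.ext_iff, funext_iff, Fin.forall_fin_succ] at h0 h1
  simp at h0 h1
  intro i
  fin_cases i <;> simp <;> linarith

/-- The solution of `y' = a y + f` with `y(0) = 0`. -/
def linSol (a : ℝ) (f : ℝ → ℝ) (s : ℝ) : ℝ :=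
  Real.exp (a * s) * ∫ r in (0 : ℝ)..s, Real.exp (-(a * r)) * f r

theorem linSol_zero (a : ℝ) (f : ℝ → ℝ) : linSol a f 0 = 0 := by simp [linSol]

theorem hasDerivAt_integral_exp (a : ℝ) {f : ℝ → ℝ} (hf : Continuous f) (s : ℝ) :
    HasDerivAt (fun s => ∫ r in (0 : ℝ)..s, Real.exp (-(a * r)) * f r)
      (Real.exp (-(a * s)) * f s) s := by
  have hc : Continuous fun r => Real.exp (-(a * r)) * f r := by fun_prop
  exact intervalIntegral.integral_hasDerivAt_right (hc.intervalIntegrable _ _)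
    (hc.stronglyMeasurableAtFilter _ _) hc.continuousAt

theorem hasDerivAt_linSol (a : ℝ) {f : ℝ → ℝ} (hf : Continuous f) (s : ℝ) :
    HasDerivAt (linSol a f) (a * linSol a f s + f s) s := by
  have h1 := hasDerivAt_integral_exp a hf s
  have h2 : HasDerivAt (fun s => Real.exp (a * s)) (Real.exp (a * s) * a) s := by
    simpa using ((hasDerivAt_id s).const_mul a).exp
  refine (h2.mul h1).congr_deriv ?_
  rw [← mul_assoc, ← Real.exp_add]
  simp [linSol]
  ring

theorem contDiff_linSol (a : ℝ) {f : ℝ → ℝ} (hf : ContDiff ℝ ∞ f) :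
    ContDiff ℝ ∞ (linSol a f) := by
  have h := hasDerivAt_integral_exp a hf.continuous
  refine ContDiff.mul (by fun_prop)
    (contDiff_infty_iff_deriv.2 ⟨fun s => (h s).differentiableAt, ?_⟩)
  rw [funext fun s => (h s).deriv]
  fun_prop

theorem linSol_const (a c s : ℝ) : linSol a (fun _ => c) s = c * linSol a (fun _ => 1) s := by
  simp [linSol]
  ring

theorem linSol_add_const (a : ℝ) {f : ℝ → ℝ} (hf : Continuous f) (c s : ℝ) :
    linSol a (fun r => f r + c) s = linSol a f s + c * linSol a (fun _ => 1) s := by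
  rw [← linSol_const, linSol, linSol, linSol, ← mul_add, ← intervalIntegral.integral_add
    ((by fun_prop : Continuous _).intervalIntegrable _ _)
    ((by fun_prop : Continuous _).intervalIntegrable _ _)]
  simp only [mul_add]

/-- A constant source enters the time-one value through this factor; being nonzero, it allows any
shift to be prescribed in `exists_flow_one_eq`. -/
theorem linSol_one_pos (a : ℝ) : 0 < linSol a (fun _ => 1) 1 := by
  refine mul_pos (Real.exp_pos _) (intervalIntegral.intervalIntegral_pos_of_pos
    ((by fun_prop : Continuous _).intervalIntegrable _ _) (fun x => ?_) one_pos)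
  simpa using Real.exp_pos _

/-- The velocity shift `k` in the flow of `field c`. -/
def flowK (c : Fin 5 → ℝ) : ℝ → ℝ := linSol (c 4 - c 3) fun _ => c 2

/-- The time shift `t₀` in the flow of `field c`. -/
def flowT (c : Fin 5 → ℝ) : ℝ → ℝ := linSol (c 3) fun _ => c 0

/-- The space shift `x₀` in the flow of `field c`. -/
def flowX (c : Fin 5 → ℝ) : ℝ → ℝ := linSol (c 4) fun r => c 2 * flowT c r + c 1

/-- The flow of `field c`. -/
def flow (c : Fin 5 → ℝ) (s : ℝ) : Total → Total :=
  similarity (Real.exp (c 3 * s)) (Real.exp ((c 4 - c 3) * s)) (flowK c s) (flowT c s) (flowX c s)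

theorem contDiff_flowK (c : Fin 5 → ℝ) : ContDiff ℝ ∞ (flowK c) :=
  contDiff_linSol _ contDiff_const

theorem contDiff_flowT (c : Fin 5 → ℝ) : ContDiff ℝ ∞ (flowT c) :=
  contDiff_linSol _ contDiff_const

theorem contDiff_flowX (c : Fin 5 → ℝ) : ContDiff ℝ ∞ (flowX c) :=
  contDiff_linSol _ ((contDiff_const.mul (contDiff_flowT c)).add contDiff_const)

theorem flow_zero (c : Fin 5 → ℝ) (y : Total) : flow c 0 y = y := by
  simp [flow, flowK, flowT, flowX, linSol_zero, similarity_one]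

theorem hasDerivAt_flow (c : Fin 5 → ℝ) (y : Total) (s : ℝ) :
    HasDerivAt (fun s => flow c s y) (field c (flow c s y)) s := by
  have he : ∀ a : ℝ, HasDerivAt (fun s => Real.exp (a * s)) (a * Real.exp (a * s)) s := fun a => by
    simpa [mul_comm] using ((hasDerivAt_id s).const_mul a).exp
  have hK : HasDerivAt (flowK c) ((c 4 - c 3) * flowK c s + c 2) s :=
    hasDerivAt_linSol _ continuous_const s
  have hT : HasDerivAt (flowT c) (c 3 * flowT c s + c 0) s :=
    hasDerivAt_linSol _ continuous_const s
  have hX : HasDerivAt (flowX c) (c 4 * flowX c s + (c 2 * flowT c s + c 1)) s :=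
    hasDerivAt_linSol _ ((continuous_const.mul (contDiff_flowT c).continuous).add
      continuous_const) s
  have h3 := he (c 3)
  have h43 := he (c 4 - c 3)
  refine HasDerivAt.prodMk (hasDerivAt_pi.2 fun i => ?_) ?_
  · fin_cases i
    · refine ((h3.mul_const (y.1 0)).add hT).congr_deriv ?_
      simp [flow, similarity]; ring
    · refine ((((h3.mul h43).mul_const (y.1 1)).add ((h3.mul hK).mul_const (y.1 0))).add
        hX).congr_deriv ?_
      simp [flow, similarity]; ring
    · refine ((h43.mul_const (y.1 2)).add hK).congr_deriv ?_
      simp [flow, similarity]; ring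
    · refine ((h43.pow 2).mul_const (y.1 3)).congr_deriv ?_
      simp [flow, similarity]; ring
  · refine ((h3.mul (h43.pow 2)).mul_const y.2).congr_deriv ?_
    simp [flow, similarity]; ring

theorem exists_lipschitzWith_field (c : Fin 5 → ℝ) : ∃ K, LipschitzWith K (field c) := by
  let L : Total →ₗ[ℝ] Total :=
    { toFun := fun y => field c y - field c 0
      map_add' := fun y y' => by apply total_ext <;> simp [field] <;> ring
      map_smul' := fun r y => by apply total_ext <;> simp [field] <;> ring }
  refine ⟨‖L.toContinuousLinearMap‖₊, ?_⟩
  have h := L.toContinuousLinearMap.lipschitz.add (LipschitzWith.const (field c 0))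
  rw [add_zero] at h
  intro y y'
  have := h y y'
  simpa [L] using this

/-- The field is affine, hence globally Lipschitz, so its integral curves are unique and coincide
with the explicit flow. -/
theorem eq_flow_one {c : Fin 5 → ℝ} {σ : Equiv.Perm Total} (h : IsTimeOneMap (field c) σ)
    (y : Total) : σ y = flow c 1 y := by
  obtain ⟨γ, h0, hγ, h1⟩ := h y
  obtain ⟨K, hK⟩ := exists_lipschitzWith_field c
  have := ODE_solution_unique_univ (v := fun _ => field c) (s := fun _ => Set.univ) (K := K) (f := γ)
    (g := fun s => flow c s y) (t₀ := 0) (fun _ => hK.lipschitzOnWith) (fun t => ⟨hγ t, trivial⟩)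
    (fun t => ⟨hasDerivAt_flow c y t, trivial⟩) (by rw [h0, flow_zero])
  rw [← h1, this]

/-- The coefficients solve a triangular system: logarithms of τ and b fix `c3` and `c4 - c3`, then
`c0` and `c2` follow from the shifts of t and u. The coefficient `c1` comes last because the boost
acting on the time shift already contributes to `x₀`. -/
theorem exists_flow_one_eq {τ b : ℝ} (hτ : 0 < τ) (hb : 0 < b) (k t₀ x₀ : ℝ) :
    ∃ c, flow c 1 = similarity τ b k t₀ x₀ := by
  have hE := fun a => (linSol_one_pos a).ne'
  set E := fun a => linSol a (fun _ => 1) 1 with hEd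
  let c3 := Real.log τ
  let c4 := Real.log b + c3
  let c0 := t₀ / E c3
  let c2 := k / E (c4 - c3)
  let c1 := (x₀ - linSol c4 (fun r => c2 * linSol c3 (fun _ => c0) r) 1) / E c4
  refine ⟨![c0, c1, c2, c3, c4], ?_⟩
  have hf : Continuous fun r => c2 * linSol c3 (fun _ => c0) r :=
    continuous_const.mul (contDiff_linSol c3 contDiff_const).continuous
  have hK : flowK ![c0, c1, c2, c3, c4] 1 = k := by
    simp only [flowK]
    rw [linSol_const]
    exact div_mul_cancel₀ _ (hE _)
  have hT : flowT ![c0, c1, c2, c3, c4] 1 = t₀ := by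
    simp only [flowT]
    rw [linSol_const]
    exact div_mul_cancel₀ _ (hE _)
  have hX : flowX ![c0, c1, c2, c3, c4] 1 = x₀ := by
    have : flowX ![c0, c1, c2, c3, c4] 1 =
        linSol c4 (fun r => c2 * linSol c3 (fun _ => c0) r + c1) 1 := rfl
    rw [this, linSol_add_const _ hf]
    have : c1 * E c4 = x₀ - linSol c4 (fun r => c2 * linSol c3 (fun _ => c0) r) 1 :=
      div_mul_cancel₀ _ (hE _)
    change _ + c1 * E c4 = _
    rw [this]; ring
  have h3 : Real.exp (![c0, c1, c2, c3, c4] 3 * 1) = τ := by simp [c3, Real.exp_log hτ]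
  have h4 : Real.exp ((![c0, c1, c2, c3, c4] 4 - ![c0, c1, c2, c3, c4] 3) * 1) = b := by
    simp [c4, Real.exp_log hb]
  rw [flow, hK, hT, hX, h3, h4]

/-! ### The groups generated -/

theorem isTimeOneMap_flow {c : Fin 5 → ℝ} {σ : Equiv.Perm Total} (h : ∀ y, σ y = flow c 1 y) :
    IsTimeOneMap (field c) σ :=
  fun y => ⟨fun s => flow c s y, flow_zero c y, hasDerivAt_flow c y, (h y).symm⟩

/-- Time-one maps have exponential, hence positive, scalings, and each similarity with positive
scalings is itself a single time-one map, so the closure adds nothing. -/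
theorem continuousGroup_eq : continuousGroup = similarityGroup (Units.posSubgroup ℝ) := by
  apply le_antisymm
  · rw [continuousGroup, Subgroup.closure_le]
    rintro σ ⟨v, hv, hσ⟩
    obtain ⟨c, rfl⟩ := mem_fieldSpan_iff.1 hv
    exact ⟨Units.mk0 _ (Real.exp_ne_zero (c 3 * 1)), Real.exp_pos _,
      Units.mk0 _ (Real.exp_ne_zero ((c 4 - c 3) * 1)), Real.exp_pos _, flowK c 1, flowT c 1,
      flowX c 1, eq_flow_one hσ⟩
  · rintro σ ⟨τ, hτ, b, hb, k, t₀, x₀, h⟩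
    obtain ⟨c, hc⟩ := exists_flow_one_eq (τ := τ) (b := b) hτ hb k t₀ x₀
    exact Subgroup.subset_closure ⟨field c, mem_fieldSpan_iff.2 ⟨c, rfl⟩,
      isTimeOneMap_flow fun y => by rw [h, hc]⟩

theorem similarity_scalings_unique {τ b k t₀ x₀ τ' b' k' t₀' x₀' : ℝ}
    (h : ∀ y, similarity τ b k t₀ x₀ y = similarity τ' b' k' t₀' x₀' y) : τ = τ' ∧ b = b' := by
  have h0 := h (0, 0)
  have h1 := h (![1, 1, 1, 1], 1)
  simp [similarity] at h0 h1
  constructor <;> linarith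

theorem discrete₁_apply (y : Total) : discrete₁ y = similarity (-1) 1 0 0 0 y := by
  apply total_ext <;> simp [similarity, discrete₁, Function.Involutive.toPerm]

theorem discrete₂_apply (y : Total) : discrete₂ y = similarity (-1) (-1) 0 0 0 y := by
  apply total_ext <;> simp [similarity, discrete₂, Function.Involutive.toPerm]

theorem pos_of_mem_continuousGroup {σ : Equiv.Perm Total} (hσ : σ ∈ continuousGroup)
    {τ b k t₀ x₀ : ℝ} (h : ∀ y, σ y = similarity τ b k t₀ x₀ y) : 0 < τ ∧ 0 < b := by
  rw [continuousGroup_eq] at hσ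
  obtain ⟨τ', hτ', b', hb', k', t₀', x₀', h'⟩ := hσ
  obtain ⟨rfl, rfl⟩ := similarity_scalings_unique fun y => (h y).symm.trans (h' y)
  exact ⟨hτ', hb'⟩

theorem discrete₁_notMem : discrete₁ ∉ continuousGroup := fun h => by
  have := pos_of_mem_continuousGroup h discrete₁_apply
  linarith

theorem discrete₂_notMem : discrete₂ ∉ continuousGroup := fun h => by
  have := pos_of_mem_continuousGroup h discrete₂_apply
  linarith

theorem discrete₁_mul_discrete₂_notMem : discrete₁ * discrete₂ ∉ continuousGroup := fun h => by
  have := pos_of_mem_continuousGroup h (τ := 1) (b := -1) (k := 0) (t₀ := 0) (x₀ := 0) fun y => by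
    rw [Equiv.Perm.mul_apply, discrete₂_apply, discrete₁_apply, similarity_comp]
    norm_num
  linarith

theorem generatedGroup_eq : generatedGroup = similarityGroup ⊤ := by
  have h₁ : discrete₁ ∈ similarityGroup ⊤ :=
    ⟨-1, trivial, 1, trivial, 0, 0, 0, fun y => by simpa using discrete₁_apply y⟩
  have h₂ : discrete₂ ∈ similarityGroup ⊤ :=
    ⟨-1, trivial, -1, trivial, 0, 0, 0, fun y => by simpa using discrete₂_apply y⟩
  apply le_antisymm
  · rw [generatedGroup, continuousGroup_eq]
    refine sup_le ?_ ?_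
    · rintro σ ⟨τ, -, b, -, h⟩
      exact ⟨τ, trivial, b, trivial, h⟩
    · rw [Subgroup.closure_le]
      rintro σ (rfl | rfl) <;> assumption
  · have hd₁ : discrete₁ ∈ generatedGroup :=
      Subgroup.mem_sup_right (Subgroup.subset_closure (by simp))
    have hd₂ : discrete₂ ∈ generatedGroup :=
      Subgroup.mem_sup_right (Subgroup.subset_closure (by simp))
    have hc : ∀ {σ : Equiv.Perm Total} {τ b k t₀ x₀ : ℝ}, 0 < τ → 0 < b →
        (∀ y, σ y = similarity τ b k t₀ x₀ y) → σ ∈ generatedGroup := by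
      intro σ τ b k t₀ x₀ hτ hb h
      refine Subgroup.mem_sup_left (continuousGroup_eq ▸ ?_)
      exact ⟨Units.mk0 τ hτ.ne', hτ, Units.mk0 b hb.ne', hb, k, t₀, x₀, h⟩
    rintro σ ⟨τ, -, b, -, k, t₀, x₀, h⟩
    -- Composing σ with an element whose scalings have the signs of τ and b makes both scalings
    -- positive, which lands in the continuous group.
    have key : ∀ d ∈ generatedGroup, ∀ e f : ℝ, (∀ y, d y = similarity e f 0 0 0 y) →
        0 < τ * e → 0 < b * f → σ ∈ generatedGroup := by
      intro d hd e f hdy hτ hb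
      refine (Subgroup.mul_mem_cancel_right _ hd).1 (hc hτ hb (k := k) (t₀ := t₀) (x₀ := x₀)
        fun y => ?_)
      rw [Equiv.Perm.mul_apply, h, hdy, similarity_comp]
      simp
    rcases lt_or_gt_of_ne τ.ne_zero with hτ | hτ <;> rcases lt_or_gt_of_ne b.ne_zero with hb | hb
    · exact key _ hd₂ _ _ discrete₂_apply (by linarith) (by linarith)
    · exact key _ hd₁ _ _ discrete₁_apply (by linarith) (by linarith)
    · refine key _ (mul_mem hd₁ hd₂) 1 (-1) (fun y => ?_) (by linarith) (by linarith)
      rw [Equiv.Perm.mul_apply, discrete₂_apply, discrete₁_apply, similarity_comp]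
      norm_num
    · exact hc hτ hb h

/-! ### Total derivatives and prolongation depend on germs only -/

theorem continuous_toBase : Continuous toBase :=
  continuous_pi fun i => by fin_cases i <;> exact continuous_apply _

theorem totalT_congr {A B : Jet → ℝ} {j : Jet} (h : A =ᶠ[𝓝 j] B) :
    totalT A =ᶠ[𝓝 j] totalT B := by
  filter_upwards [h.fderiv (𝕜 := ℝ)] with j' hj'
  rw [totalT, totalT, hj']

theorem totalX_congr {A B : Jet → ℝ} {j : Jet} (h : A =ᶠ[𝓝 j] B) :
    totalX A =ᶠ[𝓝 j] totalX B := by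
  filter_upwards [h.fderiv (𝕜 := ℝ)] with j' hj'
  rw [totalX, totalX, hj']

theorem comp_congr {g g' : Base → Base} {j : Jet} (h : g =ᶠ[𝓝 (toBase j)] g') (i : Fin 4) :
    comp g i =ᶠ[𝓝 j] comp g' i := by
  filter_upwards [continuous_toBase.continuousAt.eventually h] with j' hj'
  rw [comp, comp, hj']

theorem jac_congr {g g' : Base → Base} {j : Jet} (h : g =ᶠ[𝓝 (toBase j)] g') :
    jac g =ᶠ[𝓝 j] jac g' := by
  filter_upwards [totalT_congr (comp_congr h 0), totalT_congr (comp_congr h 1),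
    totalX_congr (comp_congr h 0), totalX_congr (comp_congr h 1)] with j' h1 h2 h3 h4
  rw [jac, jac, h1, h2, h3, h4]

theorem newT_congr {g g' : Base → Base} {A B : Jet → ℝ} {j : Jet}
    (h : g =ᶠ[𝓝 (toBase j)] g') (hA : A =ᶠ[𝓝 j] B) : newT g A =ᶠ[𝓝 j] newT g' B := by
  filter_upwards [totalT_congr (comp_congr h 1), totalX_congr (comp_congr h 1), jac_congr h,
    totalT_congr hA, totalX_congr hA] with j' h1 h2 h3 h4 h5
  rw [newT, newT, h1, h2, h3, h4, h5]

theorem newX_congr {g g' : Base → Base} {A B : Jet → ℝ} {j : Jet}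
    (h : g =ᶠ[𝓝 (toBase j)] g') (hA : A =ᶠ[𝓝 j] B) : newX g A =ᶠ[𝓝 j] newX g' B := by
  filter_upwards [totalT_congr (comp_congr h 0), totalX_congr (comp_congr h 0), jac_congr h,
    totalT_congr hA, totalX_congr hA] with j' h1 h2 h3 h4 h5
  rw [newX, newX, h1, h2, h3, h4, h5]

/-- A transformation is known to be a similarity only on an open set, while its second prolongation
iterates derivatives; equality of germs survives each total derivative, so the explicit formulas
carry over. -/
theorem prolong_congr {g g' : Base → Base} {j : Jet} (h : g =ᶠ[𝓝 (toBase j)] g') :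
    prolong g j = prolong g' j := by
  have hu := comp_congr h 2
  have hh := comp_congr h 3
  have hut := newT_congr h hu
  have hux := newX_congr h hu
  have hht := newT_congr h hh
  have hhx := newX_congr h hh
  simp only [prolong]
  rw [(comp_congr h 0).eq_of_nhds, (comp_congr h 1).eq_of_nhds, hu.eq_of_nhds, hh.eq_of_nhds,
    hut.eq_of_nhds, hux.eq_of_nhds, hht.eq_of_nhds, hhx.eq_of_nhds,
    (newT_congr h hut).eq_of_nhds, (newX_congr h hut).eq_of_nhds, (newX_congr h hux).eq_of_nhds,
    (newT_congr h hht).eq_of_nhds, (newX_congr h hht).eq_of_nhds, (newX_congr h hhx).eq_of_nhds]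

/-! ### Prolongation of similarities -/

/-- The action of a similarity on the space of `(t, x, u, h)`. -/
def similarityBase (τ b k t₀ x₀ : ℝ) (z : Base) : Base :=
  ![τ * z 0 + t₀, τ * b * z 1 + τ * k * z 0 + x₀, b * z 2 + k, b ^ 2 * z 3]

/-- The second prolongation of a similarity. -/
def similarityJet (τ b k t₀ x₀ : ℝ) (j : Jet) : Jet :=
  ![τ * j 0 + t₀, τ * b * j 1 + τ * k * j 0 + x₀, b * j 2 + k, b ^ 2 * j 3,
    (b * j 4 - k * j 5) / τ, j 5 / τ, (b ^ 2 * j 6 - b * k * j 7) / τ, b * j 7 / τ,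
    (b * j 8 - 2 * k * j 9 + k ^ 2 / b * j 10) / τ ^ 2, (b * j 9 - k * j 10) / (τ ^ 2 * b),
    j 10 / (τ ^ 2 * b),
    (b ^ 2 * j 11 - 2 * b * k * j 12 + k ^ 2 * j 13) / τ ^ 2,
    (b * j 12 - k * j 13) / τ ^ 2, j 13 / τ ^ 2]

theorem fderiv_affine (i l : Fin 14) (α β γ : ℝ) (j v : Jet) :
    fderiv ℝ (fun j : Jet => α * j i + β * j l + γ) j v = α * v i + β * v l := by
  have h : HasFDerivAt (fun j : Jet => α * j i + β * j l + γ)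
      (α • ContinuousLinearMap.proj (R := ℝ) (φ := fun _ : Fin 14 => ℝ) i +
        β • ContinuousLinearMap.proj (R := ℝ) (φ := fun _ : Fin 14 => ℝ) l) j :=
    (((hasFDerivAt_apply i j).const_mul α).add ((hasFDerivAt_apply l j).const_mul β)).add_const γ
  rw [h.fderiv]
  simp

theorem comp_similarityBase (τ b k t₀ x₀ : ℝ) :
    comp (similarityBase τ b k t₀ x₀) 0 = (fun j => τ * j 0 + 0 * j 0 + t₀) ∧
    comp (similarityBase τ b k t₀ x₀) 1 = (fun j => τ * b * j 1 + τ * k * j 0 + x₀) ∧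
    comp (similarityBase τ b k t₀ x₀) 2 = (fun j => b * j 2 + 0 * j 0 + k) ∧
    comp (similarityBase τ b k t₀ x₀) 3 = fun j => b ^ 2 * j 3 + 0 * j 0 + 0 := by
  refine ⟨?_, ?_, ?_, ?_⟩ <;> funext j <;> simp [comp, similarityBase, toBase]

theorem jac_similarityBase (τ b k t₀ x₀ : ℝ) (j : Jet) :
    jac (similarityBase τ b k t₀ x₀) j = τ ^ 2 * b := by
  obtain ⟨h0, h1, -, -⟩ := comp_similarityBase τ b k t₀ x₀
  simp only [jac, h0, h1, totalT, totalX, fderiv_affine]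
  simp
  ring

theorem newT_similarityBase {τ b : ℝ} (hτ : τ ≠ 0) (hb : b ≠ 0) (k t₀ x₀ : ℝ) (A : Jet → ℝ)
    (j : Jet) : newT (similarityBase τ b k t₀ x₀) A j =
      (totalT A j - k / b * totalX A j) / τ := by
  obtain ⟨h0, h1, -, -⟩ := comp_similarityBase τ b k t₀ x₀
  rw [newT, jac_similarityBase, h1]
  simp only [totalT, totalX, fderiv_affine]
  simp
  field_simp

theorem newX_similarityBase {τ b : ℝ} (hτ : τ ≠ 0) (hb : b ≠ 0) (k t₀ x₀ : ℝ) (A : Jet → ℝ)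
    (j : Jet) : newX (similarityBase τ b k t₀ x₀) A j = totalX A j / (τ * b) := by
  obtain ⟨h0, h1, -, -⟩ := comp_similarityBase τ b k t₀ x₀
  rw [newX, jac_similarityBase, h0]
  simp only [totalT, totalX, fderiv_affine]
  simp
  field_simp

theorem prolong_similarityBase {τ b : ℝ} (hτ : τ ≠ 0) (hb : b ≠ 0) (k t₀ x₀ : ℝ) :
    prolong (similarityBase τ b k t₀ x₀) = similarityJet τ b k t₀ x₀ := by
  obtain ⟨h0, h1, h2, h3⟩ := comp_similarityBase τ b k t₀ x₀
  set g := similarityBase τ b k t₀ x₀ with hg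
  -- The new first derivatives are again affine in the jet, so `fderiv_affine` also computes the
  -- second-order components.
  have hut : newT g (comp g 2) = fun j => b / τ * j 4 + -k / τ * j 5 + 0 := by
    funext j
    rw [hg, newT_similarityBase hτ hb, ← hg, h2, totalT, totalX, fderiv_affine, fderiv_affine]
    simp
    field_simp
    ring
  have hux : newX g (comp g 2) = fun j => 1 / τ * j 5 + 0 * j 0 + 0 := by
    funext j
    rw [hg, newX_similarityBase hτ hb, ← hg, h2, totalX, fderiv_affine]
    simp
    field_simp
  have hht : newT g (comp g 3) = fun j => b ^ 2 / τ * j 6 + -(b * k) / τ * j 7 + 0 := by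
    funext j
    rw [hg, newT_similarityBase hτ hb, ← hg, h3, totalT, totalX, fderiv_affine, fderiv_affine]
    simp
    field_simp
    ring
  have hhx : newX g (comp g 3) = fun j => b / τ * j 7 + 0 * j 0 + 0 := by
    funext j
    rw [hg, newX_similarityBase hτ hb, ← hg, h3, totalX, fderiv_affine]
    simp
    field_simp
  funext j
  simp only [prolong]
  rw [hut, hux, hht, hhx, h0, h1, h2, h3]
  simp only [hg, newT_similarityBase hτ hb, newX_similarityBase hτ hb, totalT, totalX,
    fderiv_affine]
  funext i
  fin_cases i <;> simp [similarityJet] <;> field_simp <;> ring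

theorem similarityJet_inv {τ b : ℝ} (hτ : τ ≠ 0) (hb : b ≠ 0) (k t₀ x₀ : ℝ) (j : Jet) :
    similarityJet τ⁻¹ b⁻¹ (-k / b) (-t₀ / τ) ((k * t₀ - x₀) / (τ * b))
      (similarityJet τ b k t₀ x₀ j) = j := by
  funext i
  fin_cases i <;> simp [similarityJet] <;> field_simp <;> ring

/-- The scaling of `(h, u_x, h_x)` induced by the inverse of a similarity. -/
def argsScale (τ b : ℝ) (y : Fin 3 → ℝ) : Fin 3 → ℝ := ![y 0 / b ^ 2, τ * y 1, τ * y 2 / b]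

theorem argsScale_args {τ b : ℝ} (hτ : τ ≠ 0) (hb : b ≠ 0) (k t₀ x₀ : ℝ) (j : Jet) :
    argsScale τ b (args (similarityJet τ b k t₀ x₀ j)) = args j := by
  funext i
  fin_cases i <;> simp [argsScale, similarityJet, args] <;> field_simp

theorem contDiff_argsScale (τ b : ℝ) : ContDiff ℝ ∞ (argsScale τ b) := by
  refine contDiff_pi.2 fun i => ?_
  fin_cases i <;> simp [argsScale] <;> fun_prop

/-- The arbitrary element to which a similarity maps a given one. -/
def ArbElem.transform (θ : ArbElem) {τ b : ℝ} (hτ : τ ≠ 0) (hb : b ≠ 0) : ArbElem where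
  dom := argsScale τ b ⁻¹' θ.dom
  toFun y := τ * b ^ 2 * θ.toFun (argsScale τ b y)
  isOpen_dom := θ.isOpen_dom.preimage (contDiff_argsScale τ b).continuous
  nonempty_dom := by
    obtain ⟨y, hy⟩ := θ.nonempty_dom
    refine ⟨![b ^ 2 * y 0, y 1 / τ, b * y 2 / τ], ?_⟩
    rw [Set.mem_preimage]
    convert hy using 1
    funext i
    fin_cases i <;> simp [argsScale] <;> field_simp
  smooth := contDiffOn_const.mul
    (θ.smooth.comp (contDiff_argsScale τ b).contDiffOn fun _ h => h)

/-- The left-hand sides of the two equations are multiplied by the nonzero factors b/τ and b²/τ. -/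
theorem mem_system_transform {τ b : ℝ} (hτ : τ ≠ 0) (hb : b ≠ 0) (k t₀ x₀ : ℝ) (θ : ArbElem)
    (j : Jet) : similarityJet τ b k t₀ x₀ j ∈ system (θ.transform hτ hb) ↔ j ∈ system θ := by
  have h1 : similarityJet τ b k t₀ x₀ j 4 + similarityJet τ b k t₀ x₀ j 2 *
      similarityJet τ b k t₀ x₀ j 5 + similarityJet τ b k t₀ x₀ j 7 -
      τ * b ^ 2 * θ.toFun (args j) * similarityJet τ b k t₀ x₀ j 10 =
      b / τ * (j 4 + j 2 * j 5 + j 7 - θ.toFun (args j) * j 10) := by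
    simp [similarityJet]
    field_simp
    ring
  have h2 : similarityJet τ b k t₀ x₀ j 6 + similarityJet τ b k t₀ x₀ j 2 *
      similarityJet τ b k t₀ x₀ j 7 + similarityJet τ b k t₀ x₀ j 3 *
      similarityJet τ b k t₀ x₀ j 5 = b ^ 2 / τ * (j 6 + j 2 * j 7 + j 3 * j 5) := by
    simp [similarityJet]
    field_simp
    ring
  simp only [system, ArbElem.transform, Set.mem_ofPred_eq, Set.mem_preimage,
    argsScale_args hτ hb, h1, h2]
  simp [hτ, hb]

theorem mem_graph_transform {τ b : ℝ} (hτ : τ ≠ 0) (hb : b ≠ 0) (k t₀ x₀ : ℝ) (θ : ArbElem)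
    (m : ExtJet) :
    (similarityJet τ b k t₀ x₀ m.1, τ * b ^ 2 * m.2) ∈ graph (θ.transform hτ hb) ↔
      m ∈ graph θ := by
  simp [graph, ArbElem.transform, argsScale_args hτ hb, hτ, hb]

theorem fderiv_similarityBase (τ b k t₀ x₀ : ℝ) (z v : Base) :
    fderiv ℝ (similarityBase τ b k t₀ x₀) z v =
      ![τ * v 0, τ * b * v 1 + τ * k * v 0, b * v 2, b ^ 2 * v 3] := by
  have p := fun i => hasFDerivAt_apply (𝕜 := ℝ) (F' := fun _ : Fin 4 => ℝ) i z
  have h : HasFDerivAt (similarityBase τ b k t₀ x₀) (ContinuousLinearMap.pi ![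
      τ • ContinuousLinearMap.proj (R := ℝ) (φ := fun _ : Fin 4 => ℝ) 0,
      (τ * b) • ContinuousLinearMap.proj (R := ℝ) (φ := fun _ : Fin 4 => ℝ) 1 +
        (τ * k) • ContinuousLinearMap.proj (R := ℝ) (φ := fun _ : Fin 4 => ℝ) 0,
      b • ContinuousLinearMap.proj (R := ℝ) (φ := fun _ : Fin 4 => ℝ) 2,
      b ^ 2 • ContinuousLinearMap.proj (R := ℝ) (φ := fun _ : Fin 4 => ℝ) 3]) z := by
    refine hasFDerivAt_pi.2 fun i => ?_
    fin_cases i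
    · exact ((p 0).const_mul τ).add_const t₀
    · exact (((p 1).const_mul (τ * b)).add ((p 0).const_mul (τ * k))).add_const x₀
    · exact ((p 2).const_mul b).add_const k
    · exact (p 3).const_mul (b ^ 2)
  rw [h.fderiv]
  funext i
  fin_cases i <;> simp

theorem isOpen_cylinder {U : Set Base} {W : Set ℝ} (hU : IsOpen U) (hW : IsOpen W) :
    IsOpen (cylinder U W) :=
  (hU.preimage (continuous_toBase.comp continuous_fst)).inter (hW.preimage continuous_snd)

/-- A transformation which acts over `U` and `W` as a similarity is an equivalence
transformation. -/
theorem isEquivalenceTransformation_of_similarity {S : Set ArbElem}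
    (hS : S = allElements ∨ S = nonvanishingElements) {U : Set Base} {W : Set ℝ} (hU : IsOpen U)
    (hW : IsOpen W) {τ b : ℝ} (hτ : τ ≠ 0) (hb : b ≠ 0) (k t₀ x₀ : ℝ) {φ : Transf}
    (hbase : ∀ z ∈ U, φ.base z = similarityBase τ b k t₀ x₀ z)
    (harb : ∀ m ∈ φ.domain U W, φ.arb m = τ * b ^ 2 * m.2) :
    IsEquivalenceTransformation S U W φ := by
  have hgerm : ∀ {z}, z ∈ U → φ.base =ᶠ[𝓝 z] similarityBase τ b k t₀ x₀ := fun hz => by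
    filter_upwards [hU.mem_nhds hz] with z' hz' using hbase z' hz'
  -- The Jacobian has the constant nonzero value τ²b, so the prolongation is defined over the whole
  -- cylinder.
  have hdom : φ.domain U W = cylinder U W := by
    refine Set.sep_eq_self_iff_mem_true.2 fun m hm => ?_
    rw [(jac_congr (hgerm hm.1)).eq_of_nhds, jac_similarityBase]
    positivity
  have hact : ∀ m ∈ φ.domain U W, φ.act m = (similarityJet τ b k t₀ x₀ m.1, τ * b ^ 2 * m.2) := by
    intro m hm
    rw [Transf.act, prolong_congr (hgerm hm.1.1), prolong_similarityBase hτ hb, harb m hm]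
  have hopen := isOpen_cylinder hU hW
  refine ⟨?_, ?_, ?_, ?_, ?_, ?_, ?_⟩
  · refine ContDiffOn.congr (ContDiff.contDiffOn (contDiff_pi.2 fun i => ?_)) hbase
    fin_cases i <;> simp [similarityBase] <;> fun_prop
  · intro z hz z' hz' h
    rw [hbase z hz, hbase z' hz'] at h
    have h0 := congrFun h 0
    have h1 := congrFun h 1
    have h2 := congrFun h 2
    have h3 := congrFun h 3
    simp [similarityBase, hτ, hb] at h0 h1 h2 h3
    rw [h0] at h1
    simp [hτ, hb] at h1
    funext i
    fin_cases i <;> assumption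
  · intro z hz
    rw [(hgerm hz).fderiv_eq]
    have hinj : Function.Injective (fderiv ℝ (similarityBase τ b k t₀ x₀) z) := by
      refine (injective_iff_map_eq_zero _).2 fun v hv => ?_
      rw [fderiv_similarityBase] at hv
      have h0 := congrFun hv 0
      have h1 := congrFun hv 1
      have h2 := congrFun hv 2
      have h3 := congrFun hv 3
      simp [hτ, hb] at h0 h1 h2 h3
      simp [h0, hτ, hb] at h1
      funext i
      fin_cases i <;> assumption
    exact ⟨hinj, LinearMap.surjective_of_injective
      (f := (fderiv ℝ (similarityBase τ b k t₀ x₀) z).toLinearMap) hinj⟩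
  · refine ContDiffOn.congr (ContDiff.contDiffOn ?_) harb
    fun_prop
  · intro m hm m' hm' h
    rw [hact m hm, hact m' hm', Prod.mk.injEq] at h
    refine Prod.ext ?_ (by simpa [hτ, hb] using h.2)
    rw [← similarityJet_inv hτ hb k t₀ x₀ m.1, h.1, similarityJet_inv hτ hb]
  · intro m hm
    have h1 : φ.arb =ᶠ[𝓝 m] fun m => τ * b ^ 2 * m.2 := by
      rw [hdom] at hm harb
      filter_upwards [hopen.mem_nhds hm] with m' hm' using harb m' hm'
    have h2 : HasFDerivAt (fun m : ExtJet => τ * b ^ 2 * m.2)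
        ((τ * b ^ 2) • ContinuousLinearMap.snd ℝ Jet ℝ) m :=
      hasFDerivAt_snd.const_mul _
    rw [h1.fderiv_eq, h2.fderiv]
    simp [hτ, hb]
  · intro θ hθ
    refine ⟨θ.transform hτ hb, ?_, ?_, ?_⟩
    · rcases hS with rfl | rfl
      · trivial
      · exact fun y hy => mul_ne_zero (by positivity) (hθ _ hy)
    · ext n
      constructor
      · rintro ⟨m, ⟨hm, hmd⟩, rfl⟩
        refine ⟨?_, m, hmd, rfl⟩
        rwa [hact m hmd, mem_graph_transform]
      · rintro ⟨hn, m, hmd, rfl⟩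
        refine ⟨m, ⟨?_, hmd⟩, rfl⟩
        rwa [hact m hmd, mem_graph_transform] at hn
    · rintro m ⟨-, hmd⟩
      have := congrArg Prod.fst (hact m hmd)
      simp only [Transf.act] at this
      rw [this, mem_system_transform]

/-! ### First prolongation in terms of partial derivatives -/

/-- The partial derivative with respect to the `k`-th coordinate. -/
def pd (k : Fin 4) (f : Base → ℝ) (z : Base) : ℝ := fderiv ℝ f z (Pi.single k 1)

/-- The Jacobian matrix of `g`. -/
def grad (g : Base → Base) (z : Base) (i k : Fin 4) : ℝ := pd k (fun z => g z i) z

theorem fderiv_eq_sum_pd (f : Base → ℝ) (z v : Base) :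
    fderiv ℝ f z v = v 0 * pd 0 f z + v 1 * pd 1 f z + v 2 * pd 2 f z + v 3 * pd 3 f z := by
  have hv : v = ∑ k, v k • (Pi.single k 1 : Base) := by
    simpa [← Pi.single_smul'] using (Finset.univ_sum_single v).symm
  conv_lhs => rw [hv]
  simp [Fin.sum_univ_four, pd]

theorem fderiv_apply_eq_sum {g : Base → Base} {z : Base} (hg : DifferentiableAt ℝ g z) (v : Base)
    (i : Fin 4) : fderiv ℝ g z v i = v 0 * grad g z i 0 + v 1 * grad g z i 1 +
      v 2 * grad g z i 2 + v 3 * grad g z i 3 := by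
  have h := (hasFDerivAt_pi'.1 hg.hasFDerivAt i).fderiv
  simp only [grad]
  rw [← fderiv_eq_sum_pd, h]
  rfl

/-- `toBase` as a continuous linear map. -/
def toBaseL : Jet →L[ℝ] Base :=
  ContinuousLinearMap.pi fun i => ContinuousLinearMap.proj (R := ℝ) (φ := fun _ : Fin 14 => ℝ)
    (Fin.castLE (by norm_num) i)

theorem toBaseL_apply (j : Jet) : toBaseL j = toBase j := by
  funext i
  fin_cases i <;> rfl

theorem fderiv_comp_toBase {f : Base → ℝ} {j : Jet} (hf : DifferentiableAt ℝ f (toBase j))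
    (v : Jet) : fderiv ℝ (fun j => f (toBase j)) j v = fderiv ℝ f (toBase j) (toBase v) := by
  have h : HasFDerivAt (fun j => f (toBaseL j)) ((fderiv ℝ f (toBase j)).comp toBaseL) j := by
    refine HasFDerivAt.comp j ?_ toBaseL.hasFDerivAt
    rw [toBaseL_apply]
    exact hf.hasFDerivAt
  simp only [toBaseL_apply] at h
  rw [h.fderiv, ContinuousLinearMap.comp_apply, toBaseL_apply]

theorem totalT_comp {g : Base → Base} {j : Jet} (hg : DifferentiableAt ℝ g (toBase j))
    (i : Fin 4) : totalT (comp g i) j = grad g (toBase j) i 0 + j 4 * grad g (toBase j) i 2 +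
      j 6 * grad g (toBase j) i 3 := by
  have hi := differentiableAt_pi.1 hg i
  change fderiv ℝ (fun j => (fun z => g z i) (toBase j)) j _ = _
  rw [fderiv_comp_toBase hi, fderiv_eq_sum_pd]
  simp [toBase, grad]

theorem totalX_comp {g : Base → Base} {j : Jet} (hg : DifferentiableAt ℝ g (toBase j))
    (i : Fin 4) : totalX (comp g i) j = grad g (toBase j) i 1 + j 5 * grad g (toBase j) i 2 +
      j 7 * grad g (toBase j) i 3 := by
  have hi := differentiableAt_pi.1 hg i
  change fderiv ℝ (fun j => (fun z => g z i) (toBase j)) j _ = _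
  rw [fderiv_comp_toBase hi, fderiv_eq_sum_pd]
  simp [toBase, grad]

theorem args_prolong (g : Base → Base) (j : Jet) :
    args (prolong g j) = ![comp g 3 j, newX g (comp g 2) j, newX g (comp g 3) j] := rfl

/-- The jet over `z` with `u_t = p`, `u_x = q`, `h_t = r`, `h_x = s`, `u_xx = w`, `h_xx = y`, the
other second derivatives being zero. -/
def jet (z : Base) (p q r s w y : ℝ) : Jet :=
  ![z 0, z 1, z 2, z 3, p, q, r, s, 0, 0, w, 0, 0, y]

theorem toBase_jet (z : Base) (p q r s w y : ℝ) : toBase (jet z p q r s w y) = z := by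
  funext i
  fin_cases i <;> rfl

theorem totalT_comp_jet {g : Base → Base} {z : Base} (hg : DifferentiableAt ℝ g z)
    (i : Fin 4) (p q r s w y : ℝ) : totalT (comp g i) (jet z p q r s w y) =
      grad g z i 0 + p * grad g z i 2 + r * grad g z i 3 := by
  rw [totalT_comp (by rwa [toBase_jet]), toBase_jet]
  rfl

theorem totalX_comp_jet {g : Base → Base} {z : Base} (hg : DifferentiableAt ℝ g z)
    (i : Fin 4) (p q r s w y : ℝ) : totalX (comp g i) (jet z p q r s w y) =
      grad g z i 1 + q * grad g z i 2 + s * grad g z i 3 := by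
  rw [totalX_comp (by rwa [toBase_jet]), toBase_jet]
  rfl

/-! ### Consequences of mapping the class to itself -/

/-- The constant arbitrary element on an open set. -/
def constElem (c : ℝ) {D : Set (Fin 3 → ℝ)} (hD : IsOpen D) (hne : D.Nonempty) : ArbElem where
  dom := D
  toFun _ := c
  isOpen_dom := hD
  nonempty_dom := hne
  smooth := contDiffOn_const

theorem constElem_mem {S : Set ArbElem} (hS : S = allElements ∨ S = nonvanishingElements) {c : ℝ}
    (hc : c ≠ 0) {D : Set (Fin 3 → ℝ)} (hD : IsOpen D) (hne : D.Nonempty) :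
    constElem c hD hne ∈ S := by
  rcases hS with rfl | rfl
  · trivial
  · exact fun _ _ => hc

namespace IsEquivalenceTransformation

variable {S : Set ArbElem} {U : Set Base} {W : Set ℝ} {φ : Transf}

/-- The constant element c on all of ℝ³ is mapped to a single element, whose function is `f`. Hence
the new value of F depends on the jet only through the new arguments, and solution jets go to
solution jets. -/
theorem exists_arb_eq (h : IsEquivalenceTransformation S U W φ)
    (hS : S = allElements ∨ S = nonvanishingElements) {c : ℝ} (hc : c ∈ W) (hc0 : c ≠ 0) :
    ∃ f : (Fin 3 → ℝ) → ℝ, ∀ j, toBase j ∈ U → jac φ.base j ≠ 0 →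
      φ.arb (j, c) = f (args (prolong φ.base j)) ∧
      (j 4 + j 2 * j 5 + j 7 - c * j 10 = 0 → j 6 + j 2 * j 7 + j 3 * j 5 = 0 →
        prolong φ.base j 4 + prolong φ.base j 2 * prolong φ.base j 5 + prolong φ.base j 7 -
          f (args (prolong φ.base j)) * prolong φ.base j 10 = 0 ∧
        prolong φ.base j 6 + prolong φ.base j 2 * prolong φ.base j 7 +
          prolong φ.base j 3 * prolong φ.base j 5 = 0) := by
  obtain ⟨θ', -, h1, h2⟩ := h.maps_class _
    (constElem_mem hS hc0 isOpen_univ Set.univ_nonempty)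
  refine ⟨θ'.toFun, fun j hj hjac => ?_⟩
  have hm : ((j, c) : ExtJet) ∈ graph (constElem c isOpen_univ Set.univ_nonempty) ∩
      φ.domain U W := ⟨⟨trivial, rfl⟩, ⟨hj, hc⟩, hjac⟩
  have h3 := Set.mem_image_of_mem φ.act hm
  rw [h1] at h3
  exact ⟨h3.1.2, fun e1 e2 => ((h2 _ hm).1 ⟨trivial, e1, e2⟩).2⟩

/-- If the old arguments differed, the constant element on the complement of `{args j'}` would
contain j in its graph but not j'. Membership of the images in the target graph depends only on the
new arguments, because the new values of F agree by `exists_arb_eq`. So the image of j' would be in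
it too, which injectivity of the action excludes. -/
theorem args_eq_of_args_prolong_eq (h : IsEquivalenceTransformation S U W φ)
    (hS : S = allElements ∨ S = nonvanishingElements) {c : ℝ} (hc : c ∈ W) (hc0 : c ≠ 0)
    {j j' : Jet} (hj : toBase j ∈ U) (hjac : jac φ.base j ≠ 0) (hj' : toBase j' ∈ U)
    (hjac' : jac φ.base j' ≠ 0) (he : args (prolong φ.base j) = args (prolong φ.base j')) :
    args j = args j' := by
  by_contra hne
  have hD : IsOpen {args j'}ᶜ := isClosed_singleton.isOpen_compl
  have hDne : ({args j'}ᶜ : Set (Fin 3 → ℝ)).Nonempty := ⟨args j, hne⟩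
  obtain ⟨θ', -, h1, -⟩ := h.maps_class _ (constElem_mem hS hc0 hD hDne)
  obtain ⟨f, hf⟩ := h.exists_arb_eq hS hc hc0
  have hm : ((j, c) : ExtJet) ∈ φ.domain U W := ⟨⟨hj, hc⟩, hjac⟩
  have hm' : ((j', c) : ExtJet) ∈ φ.domain U W := ⟨⟨hj', hc⟩, hjac'⟩
  have h3 : φ.act (j, c) ∈ graph θ' ∩ φ.act '' φ.domain U W := by
    rw [← h1]
    exact ⟨(j, c), ⟨⟨hne, rfl⟩, hm⟩, rfl⟩
  have h4 : φ.act (j', c) ∈ graph θ' ∩ φ.act '' φ.domain U W := by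
    refine ⟨?_, _, hm', rfl⟩
    have h5 := h3.1
    simp only [graph, Transf.act, Set.mem_ofPred_eq] at h5 ⊢
    rwa [(hf j' hj' hjac').1, ← he, ← (hf j hj hjac).1]
  rw [← h1] at h4
  obtain ⟨m, ⟨hm1, hm2⟩, hm3⟩ := h4
  rw [h.injOn_act hm2 hm' hm3] at hm1
  exact hm1.1 rfl

/-! ### Nondegeneracy of the Jacobian matrix -/

theorem differentiableAt_base (h : IsEquivalenceTransformation S U W φ) (hU : IsOpen U)
    {z : Base} (hz : z ∈ U) : DifferentiableAt ℝ φ.base z :=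
  (h.smooth_base.contDiffAt (hU.mem_nhds hz)).differentiableAt (by simp)

/-- The rows of the Jacobian matrix are linearly independent. -/
theorem row_eq_zero (h : IsEquivalenceTransformation S U W φ) (hU : IsOpen U) {z : Base}
    (hz : z ∈ U) {α : Fin 4 → ℝ} (hα : ∀ k, α 0 * grad φ.base z 0 k + α 1 * grad φ.base z 1 k +
      α 2 * grad φ.base z 2 k + α 3 * grad φ.base z 3 k = 0) : α = 0 := by
  obtain ⟨v, hv⟩ := (h.bijective_base z hz).2 α
  have hi := fun i => (congrFun hv i).symm.trans
    (fderiv_apply_eq_sum (h.differentiableAt_base hU hz) v i)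
  -- As α is the image of v under the Jacobian matrix, |α|² pairs v with the vanishing combination
  -- of rows.
  have hs : α 0 ^ 2 + α 1 ^ 2 + α 2 ^ 2 + α 3 ^ 2 = 0 := by
    linear_combination α 0 * hi 0 + α 1 * hi 1 + α 2 * hi 2 + α 3 * hi 3 + v 0 * hα 0 +
      v 1 * hα 1 + v 2 * hα 2 + v 3 * hα 3
  funext i
  fin_cases i <;> simp <;> nlinarith [sq_nonneg (α 0), sq_nonneg (α 1), sq_nonneg (α 2),
    sq_nonneg (α 3)]

/-- The columns of the Jacobian matrix do not vanish. -/
theorem col_ne_zero (h : IsEquivalenceTransformation S U W φ) (hU : IsOpen U) {z : Base}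
    (hz : z ∈ U) (k : Fin 4) : ∃ i, grad φ.base z i k ≠ 0 := by
  by_contra! hne
  have h0 : fderiv ℝ φ.base z (Pi.single k 1) = fderiv ℝ φ.base z 0 := by
    funext i
    rw [fderiv_apply_eq_sum (h.differentiableAt_base hU hz), map_zero]
    have := hne i
    fin_cases k <;> simpa using this
  have := congrFun ((h.bijective_base z hz).1 h0) k
  simp at this

theorem jac_jet (h : IsEquivalenceTransformation S U W φ) (hU : IsOpen U) {z : Base}
    (hz : z ∈ U) (p q r s w y : ℝ) : jac φ.base (jet z p q r s w y) =
      (grad φ.base z 0 0 + p * grad φ.base z 0 2 + r * grad φ.base z 0 3) *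
        (grad φ.base z 1 1 + q * grad φ.base z 1 2 + s * grad φ.base z 1 3) -
      (grad φ.base z 0 1 + q * grad φ.base z 0 2 + s * grad φ.base z 0 3) *
        (grad φ.base z 1 0 + p * grad φ.base z 1 2 + r * grad φ.base z 1 3) := by
  have hd := h.differentiableAt_base hU hz
  simp only [jac, totalT_comp_jet hd, totalX_comp_jet hd]

/-- The Jacobian is a polynomial in the first derivatives whose coefficients are, up to sign, the
2×2 minors of the first two rows. If it vanished identically, these rows would be dependent. -/
theorem exists_jac_ne_zero (h : IsEquivalenceTransformation S U W φ) (hU : IsOpen U) {z : Base}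
    (hz : z ∈ U) : ∃ p q r s : ℝ, ∀ w y, jac φ.base (jet z p q r s w y) ≠ 0 := by
  by_contra! hne
  set a := grad φ.base z with ha
  have hJ : ∀ p q r s : ℝ, (a 0 0 + p * a 0 2 + r * a 0 3) * (a 1 1 + q * a 1 2 + s * a 1 3) -
      (a 0 1 + q * a 0 2 + s * a 0 3) * (a 1 0 + p * a 1 2 + r * a 1 3) = 0 := by
    intro p q r s
    obtain ⟨w, y, hwy⟩ := hne p q r s
    rwa [h.jac_jet hU hz] at hwy
  have m01 : a 0 0 * a 1 1 = a 0 1 * a 1 0 := by linear_combination hJ 0 0 0 0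
  have m21 : a 0 2 * a 1 1 = a 0 1 * a 1 2 := by linear_combination hJ 1 0 0 0 - hJ 0 0 0 0
  have m31 : a 0 3 * a 1 1 = a 0 1 * a 1 3 := by linear_combination hJ 0 0 1 0 - hJ 0 0 0 0
  have m02 : a 0 0 * a 1 2 = a 0 2 * a 1 0 := by linear_combination hJ 0 1 0 0 - hJ 0 0 0 0
  have m03 : a 0 0 * a 1 3 = a 0 3 * a 1 0 := by linear_combination hJ 0 0 0 1 - hJ 0 0 0 0
  have m23 : a 0 2 * a 1 3 = a 0 3 * a 1 2 := by
    linear_combination hJ 1 0 0 1 - hJ 1 0 0 0 - hJ 0 0 0 1 + hJ 0 0 0 0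
  have key : ∀ l, a 0 l = 0 := by
    intro l
    have := h.row_eq_zero hU hz (α := ![a 1 l, -a 0 l, 0, 0]) fun k => by
      rw [← ha]
      fin_cases l <;> fin_cases k <;> simp <;> linarith
    simpa using congrFun this 1
  have := congrFun (h.row_eq_zero hU hz (α := ![1, 0, 0, 0]) fun k => by simp [← ha, key k]) 0
  simp at this

end IsEquivalenceTransformation

/-- An analytic function on a normed space which vanishes where the continuous function `J` does not
vanish is zero, unless `J` is zero. -/
theorem eq_zero_of_analytic {E : Type*} [NormedAddCommGroup E] [NormedSpace ℝ E] {f J : E → ℝ}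
    (hf : ContDiff ℝ ω f) (hJ : Continuous J) {v₀ : E} (hv₀ : J v₀ ≠ 0)
    (h : ∀ v, J v ≠ 0 → f v = 0) (v : E) : f v = 0 := by
  have h0 : f =ᶠ[𝓝 v₀] fun _ => 0 := by
    filter_upwards [hJ.continuousAt.eventually_ne hv₀] with v hv using h v hv
  exact congrFun ((contDiff_omega_iff_analyticOnNhd.1 hf).eq_of_eventuallyEq analyticOnNhd_const h0) v

/-! ### The new time as a function of the old time -/

namespace IsEquivalenceTransformation

variable {S : Set ArbElem} {U : Set Base} {W : Set ℝ} {φ : Transf}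

/-- The new time depends on the time only. -/
theorem grad_time (h : IsEquivalenceTransformation S U W φ)
    (hS : S = allElements ∨ S = nonvanishingElements) (hU : IsOpen U) {c : ℝ} (hc : c ∈ W)
    (hc0 : c ≠ 0) {z : Base} (hz : z ∈ U) :
    grad φ.base z 0 1 = 0 ∧ grad φ.base z 0 2 = 0 ∧ grad φ.base z 0 3 = 0 := by
  have hd := h.differentiableAt_base hU hz
  set a := grad φ.base z with ha
  have key : ∀ p q r s : ℝ, (a 0 0 + p * a 0 2 + r * a 0 3) * (a 1 1 + q * a 1 2 + s * a 1 3) -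
      (a 0 1 + q * a 0 2 + s * a 0 3) * (a 1 0 + p * a 1 2 + r * a 1 3) ≠ 0 →
      a 0 1 + q * a 0 2 + s * a 0 3 = 0 := by
    intro p q r s hJ
    -- Moving (u_t, u_x) by ε(D_t t', D_x t') multiplies the Jacobian by 1 + ε t'_u and leaves the
    -- new x-derivatives unchanged. So u_x must not change either, which gives D_x t' = 0. The
    -- choice ε = ±1 only keeps the factor nonzero.
    obtain ⟨ε, hε, hε'⟩ : ∃ ε : ℝ, ε ≠ 0 ∧ 1 + ε * a 0 2 ≠ 0 := by
      by_cases h1 : a 0 2 = -1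
      · exact ⟨-1, by norm_num, by rw [h1]; norm_num⟩
      · exact ⟨1, one_ne_zero, fun h2 => h1 (by linarith)⟩
    set P := p + ε * (a 0 0 + p * a 0 2 + r * a 0 3) with hP
    set Q := q + ε * (a 0 1 + q * a 0 2 + s * a 0 3) with hQ
    have hJ2 : (a 0 0 + P * a 0 2 + r * a 0 3) * (a 1 1 + Q * a 1 2 + s * a 1 3) -
      (a 0 1 + Q * a 0 2 + s * a 0 3) * (a 1 0 + P * a 1 2 + r * a 1 3) = (1 + ε * a 0 2) *
      ((a 0 0 + p * a 0 2 + r * a 0 3) * (a 1 1 + q * a 1 2 + s * a 1 3) -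
      (a 0 1 + q * a 0 2 + s * a 0 3) * (a 1 0 + p * a 1 2 + r * a 1 3)) := by
      rw [hP, hQ]; ring
    have e1 : jac φ.base (jet z p q r s 0 0) ≠ 0 := by rwa [h.jac_jet hU hz]
    have e2 : jac φ.base (jet z P Q r s 0 0) ≠ 0 := by
      rw [h.jac_jet hU hz, ← ha, hJ2]
      exact mul_ne_zero hε' hJ
    have hx : ∀ i, newX φ.base (comp φ.base i) (jet z p q r s 0 0) =
        newX φ.base (comp φ.base i) (jet z P Q r s 0 0) := by
      intro i
      simp only [newX, h.jac_jet hU hz, totalT_comp_jet hd, totalX_comp_jet hd, ← ha]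
      rw [hJ2, div_eq_div_iff hJ (mul_ne_zero hε' hJ), hP, hQ]
      ring
    have := h.args_eq_of_args_prolong_eq hS hc hc0 (j := jet z p q r s 0 0)
      (j' := jet z P Q r s 0 0) (by rwa [toBase_jet]) e1 (by rwa [toBase_jet]) e2 (by
        rw [args_prolong, args_prolong, hx, hx, comp, comp, toBase_jet, toBase_jet])
    have h1 : q = Q := congrFun this 1
    have h2 : ε * (a 0 1 + q * a 0 2 + s * a 0 3) = 0 := by linear_combination hQ - h1
    exact (mul_eq_zero.1 h2).resolve_left hε
  obtain ⟨p, q, r, s, hne⟩ := h.exists_jac_ne_zero hU hz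
  have hne := hne 0 0
  rw [h.jac_jet hU hz, ← ha] at hne
  -- The relation is polynomial in the jet variables, so it extends across the zeros of the Jacobian
  -- and its coefficients can be read off.
  have all := eq_zero_of_analytic (E := ℝ × ℝ × ℝ × ℝ)
    (f := fun v => a 0 1 + v.2.1 * a 0 2 + v.2.2.2 * a 0 3)
    (J := fun v => (a 0 0 + v.1 * a 0 2 + v.2.2.1 * a 0 3) *
      (a 1 1 + v.2.1 * a 1 2 + v.2.2.2 * a 1 3) - (a 0 1 + v.2.1 * a 0 2 + v.2.2.2 * a 0 3) *
      (a 1 0 + v.1 * a 1 2 + v.2.2.1 * a 1 3)) (v₀ := (p, q, r, s))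
    (by fun_prop) (by fun_prop) hne (fun v hv => key _ _ _ _ hv)
  have h0 := all (0, 0, 0, 0)
  have h1 := all (0, 1, 0, 0)
  have h2 := all (0, 0, 0, 1)
  simp only at h0 h1 h2
  refine ⟨?_, ?_, ?_⟩ <;> linarith

end IsEquivalenceTransformation

theorem contDiffAt_pd {f : Base → ℝ} {z : Base} (hf : ContDiffAt ℝ ∞ f z) (k : Fin 4) :
    ContDiffAt ℝ ∞ (pd k f) z :=
  (hf.fderiv_right (m := ∞) (by simp)).clm_apply contDiffAt_const

namespace IsEquivalenceTransformation

/-! ### Prolongation over a reparametrised time; mass conservation -/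

variable {S : Set ArbElem} {U : Set Base} {W : Set ℝ} {φ : Transf}

theorem grad_time_ne_zero (h : IsEquivalenceTransformation S U W φ)
    (hS : S = allElements ∨ S = nonvanishingElements) (hU : IsOpen U) {c : ℝ} (hc : c ∈ W)
    (hc0 : c ≠ 0) {z : Base} (hz : z ∈ U) : grad φ.base z 0 0 ≠ 0 := by
  intro h0
  obtain ⟨h1, h2, h3⟩ := h.grad_time hS hU hc hc0 hz
  have := congrFun (h.row_eq_zero hU hz (α := ![1, 0, 0, 0]) fun k => by
    fin_cases k <;> simp [h0, h1, h2, h3]) 0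
  simp at this

theorem jac_eq (h : IsEquivalenceTransformation S U W φ)
    (hS : S = allElements ∨ S = nonvanishingElements) (hU : IsOpen U) {c : ℝ} (hc : c ∈ W)
    (hc0 : c ≠ 0) {j : Jet} (hj : toBase j ∈ U) : jac φ.base j =
      grad φ.base (toBase j) 0 0 * (grad φ.base (toBase j) 1 1 +
        j 5 * grad φ.base (toBase j) 1 2 + j 7 * grad φ.base (toBase j) 1 3) := by
  have hd := h.differentiableAt_base hU hj
  obtain ⟨h1, h2, h3⟩ := h.grad_time hS hU hc hc0 hj
  simp only [jac, totalT_comp hd, totalX_comp hd, h1, h2, h3]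
  ring

/-- Since D_x t' = 0, the factor t'_t cancels and the new x-derivative is D_x divided by D_x x'. -/
theorem newX_eq (h : IsEquivalenceTransformation S U W φ)
    (hS : S = allElements ∨ S = nonvanishingElements) (hU : IsOpen U) {c : ℝ} (hc : c ∈ W)
    (hc0 : c ≠ 0) {j : Jet} (hj : toBase j ∈ U) (A : Jet → ℝ) : newX φ.base A j =
      totalX A j / (grad φ.base (toBase j) 1 1 +
        j 5 * grad φ.base (toBase j) 1 2 + j 7 * grad φ.base (toBase j) 1 3) := by
  have hd := h.differentiableAt_base hU hj
  obtain ⟨h1, h2, h3⟩ := h.grad_time hS hU hc hc0 hj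
  rw [newX, h.jac_eq hS hU hc hc0 hj, totalT_comp hd, totalX_comp hd, h1, h2, h3]
  simp only [mul_zero, add_zero, zero_mul, sub_zero]
  rw [mul_div_mul_left _ _ (h.grad_time_ne_zero hS hU hc hc0 hj)]

theorem newX_comp_jet (h : IsEquivalenceTransformation S U W φ)
    (hS : S = allElements ∨ S = nonvanishingElements) (hU : IsOpen U) {c : ℝ} (hc : c ∈ W)
    (hc0 : c ≠ 0) {z : Base} (hz : z ∈ U) (i : Fin 4) (p q r s w y : ℝ) :
    newX φ.base (comp φ.base i) (jet z p q r s w y) =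
      (grad φ.base z i 1 + q * grad φ.base z i 2 + s * grad φ.base z i 3) /
        (grad φ.base z 1 1 + q * grad φ.base z 1 2 + s * grad φ.base z 1 3) := by
  rw [h.newX_eq hS hU hc hc0 (by rwa [toBase_jet]),
    totalX_comp_jet (h.differentiableAt_base hU hz), toBase_jet]
  rfl

theorem newT_comp_jet (h : IsEquivalenceTransformation S U W φ)
    (hS : S = allElements ∨ S = nonvanishingElements) (hU : IsOpen U) {c : ℝ} (hc : c ∈ W)
    (hc0 : c ≠ 0) {z : Base} (hz : z ∈ U) (i : Fin 4) (p q r s w y : ℝ) :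
    newT φ.base (comp φ.base i) (jet z p q r s w y) =
      ((grad φ.base z 1 1 + q * grad φ.base z 1 2 + s * grad φ.base z 1 3) *
          (grad φ.base z i 0 + p * grad φ.base z i 2 + r * grad φ.base z i 3) -
        (grad φ.base z 1 0 + p * grad φ.base z 1 2 + r * grad φ.base z 1 3) *
          (grad φ.base z i 1 + q * grad φ.base z i 2 + s * grad φ.base z i 3)) /
      (grad φ.base z 0 0 *
        (grad φ.base z 1 1 + q * grad φ.base z 1 2 + s * grad φ.base z 1 3)) := by
  have hd := h.differentiableAt_base hU hz
  rw [newT, h.jac_eq hS hU hc hc0 (by rwa [toBase_jet]), toBase_jet]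
  simp only [totalT_comp_jet hd, totalX_comp_jet hd]
  rfl

theorem exists_grad_space_ne_zero (h : IsEquivalenceTransformation S U W φ)
    (hS : S = allElements ∨ S = nonvanishingElements) (hU : IsOpen U) {c : ℝ} (hc : c ∈ W)
    (hc0 : c ≠ 0) {z : Base} (hz : z ∈ U) : ∃ q s : ℝ,
    grad φ.base z 1 1 + q * grad φ.base z 1 2 + s * grad φ.base z 1 3 ≠ 0 := by
  obtain ⟨p, q, r, s, hne⟩ := h.exists_jac_ne_zero hU hz
  refine ⟨q, s, fun h0 => hne 0 0 ?_⟩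
  rw [h.jac_eq hS hU hc hc0 (by rwa [toBase_jet]), toBase_jet]
  exact mul_eq_zero_of_right _ h0

/-- The transformed equation of mass conservation, in terms of the original variables. -/
theorem mass_eq (h : IsEquivalenceTransformation S U W φ)
    (hS : S = allElements ∨ S = nonvanishingElements) (hU : IsOpen U) {c : ℝ} (hc : c ∈ W)
    (hc0 : c ≠ 0) {z : Base} (hz : z ∈ U) (p q s : ℝ) :
    (grad φ.base z 1 1 + q * grad φ.base z 1 2 + s * grad φ.base z 1 3) *
        (grad φ.base z 3 0 + p * grad φ.base z 3 2 - (z 2 * s + z 3 * q) * grad φ.base z 3 3) -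
      (grad φ.base z 1 0 + p * grad φ.base z 1 2 - (z 2 * s + z 3 * q) * grad φ.base z 1 3) *
        (grad φ.base z 3 1 + q * grad φ.base z 3 2 + s * grad φ.base z 3 3) +
      grad φ.base z 0 0 *
        (φ.base z 2 * (grad φ.base z 3 1 + q * grad φ.base z 3 2 + s * grad φ.base z 3 3) +
        φ.base z 3 * (grad φ.base z 2 1 + q * grad φ.base z 2 2 + s * grad φ.base z 2 3)) = 0 := by
  obtain ⟨q₀, s₀, h₀⟩ := h.exists_grad_space_ne_zero hS hU hc hc0 hz
  have hτ := h.grad_time_ne_zero hS hU hc hc0 hz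
  set a := grad φ.base z with ha
  refine eq_zero_of_analytic (E := ℝ × ℝ × ℝ) (v₀ := (0, q₀, s₀))
    (J := fun v => a 1 1 + v.2.1 * a 1 2 + v.2.2 * a 1 3)
    (f := fun v => (a 1 1 + v.2.1 * a 1 2 + v.2.2 * a 1 3) *
        (a 3 0 + v.1 * a 3 2 - (z 2 * v.2.2 + z 3 * v.2.1) * a 3 3) -
      (a 1 0 + v.1 * a 1 2 - (z 2 * v.2.2 + z 3 * v.2.1) * a 1 3) *
        (a 3 1 + v.2.1 * a 3 2 + v.2.2 * a 3 3) +
      a 0 0 * (φ.base z 2 * (a 3 1 + v.2.1 * a 3 2 + v.2.2 * a 3 3) +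
        φ.base z 3 * (a 2 1 + v.2.1 * a 2 2 + v.2.2 * a 2 3)))
    (by fun_prop) (by fun_prop) h₀ ?_ (p, q, s)
  rintro ⟨p, q, s⟩ hℓ
  simp only at hℓ ⊢
  obtain ⟨f, hf⟩ := h.exists_arb_eq hS hc hc0
  -- Here h_t is solved from mass conservation and u_xx from the momentum equation, using c ≠ 0.
  -- Thus p, q, s remain free, and the new mass equation contains no second derivatives.
  set j := jet z p q (-(z 2 * s + z 3 * q)) s ((p + z 2 * q + s) / c) 0 with hj
  have hjU : toBase j ∈ U := by rwa [hj, toBase_jet]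
  have hjac : jac φ.base j ≠ 0 := by
    rw [h.jac_eq hS hU hc hc0 hjU, hj, toBase_jet]
    exact mul_ne_zero hτ hℓ
  have e := ((hf j hjU hjac).2 (by simp [hj, jet]; field_simp; ring) (by simp [hj, jet])).2
  change newT φ.base (comp φ.base 3) j + φ.base (toBase j) 2 * newX φ.base (comp φ.base 3) j +
    φ.base (toBase j) 3 * newX φ.base (comp φ.base 2) j = 0 at e
  rw [hj, toBase_jet, h.newT_comp_jet hS hU hc hc0 hz, h.newX_comp_jet hS hU hc hc0 hz,
    h.newX_comp_jet hS hU hc hc0 hz, ← ha] at e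
  field_simp at e
  linear_combination e

/-- The new space and height variables do not depend on the velocity. -/
theorem grad_velocity (h : IsEquivalenceTransformation S U W φ)
    (hS : S = allElements ∨ S = nonvanishingElements) (hU : IsOpen U) {c : ℝ} (hc : c ∈ W)
    (hc0 : c ≠ 0) {z : Base} (hz : z ∈ U) :
    grad φ.base z 1 2 = 0 ∧ grad φ.base z 3 2 = 0 := by
  have E := h.mass_eq hS hU hc hc0 hz
  have hτ := h.grad_time_ne_zero hS hU hc hc0 hz
  obtain ⟨h1, h2, h3⟩ := h.grad_time hS hU hc hc0 hz
  set a := grad φ.base z with ha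
  -- These are the coefficients of p and of ps. They say that `a 3 2` times row 1 minus `a 1 2`
  -- times row 3 vanishes outside the t column. Row 0 is supported in that column, so a multiple of
  -- it completes a vanishing combination of rows.
  have m1 : a 1 1 * a 3 2 - a 1 2 * a 3 1 = 0 := by linear_combination E 1 0 0 - E 0 0 0
  have m2 : a 1 3 * a 3 2 - a 1 2 * a 3 3 = 0 := by
    linear_combination E 1 0 1 - E 0 0 1 - E 1 0 0 + E 0 0 0
  have := h.row_eq_zero hU hz
    (α := ![-(a 3 2 * a 1 0 - a 1 2 * a 3 0) / a 0 0, a 3 2, 0, -a 1 2]) fun k => by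
      rw [← ha]
      fin_cases k
      · simp; field_simp; ring
      · simp [h1]; linear_combination m1
      · simp [h2]; ring
      · simp [h3]; linear_combination m2
  have e1 := congrFun this 1
  have e3 := congrFun this 3
  simp at e1 e3
  exact ⟨e3, e1⟩

theorem grad_velocity_ne_zero (h : IsEquivalenceTransformation S U W φ)
    (hS : S = allElements ∨ S = nonvanishingElements) (hU : IsOpen U) {c : ℝ} (hc : c ∈ W)
    (hc0 : c ≠ 0) {z : Base} (hz : z ∈ U) : grad φ.base z 2 2 ≠ 0 := by
  obtain ⟨-, h2, -⟩ := h.grad_time hS hU hc hc0 hz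
  obtain ⟨h3, h4⟩ := h.grad_velocity hS hU hc hc0 hz
  obtain ⟨i, hi⟩ := h.col_ne_zero hU hz 2
  fin_cases i <;> simp_all

/-! ### The second derivative of the velocity -/

theorem contDiffAt_coord (h : IsEquivalenceTransformation S U W φ) (hU : IsOpen U) {z : Base}
    (hz : z ∈ U) (i : Fin 4) : ContDiffAt ℝ ∞ (fun z => φ.base z i) z :=
  contDiffAt_pi.1 (h.smooth_base.contDiffAt (hU.mem_nhds hz)) i

theorem contDiffAt_grad (h : IsEquivalenceTransformation S U W φ) (hU : IsOpen U) {z : Base}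
    (hz : z ∈ U) (i k : Fin 4) : ContDiffAt ℝ ∞ (fun z => grad φ.base z i k) z :=
  contDiffAt_pd (h.contDiffAt_coord hU hz i) k

/-- The new `u_xx` depends on the old `u_xx` and `h_xx` in an affine way. -/
theorem exists_prolong_jet_ten (h : IsEquivalenceTransformation S U W φ)
    (hS : S = allElements ∨ S = nonvanishingElements) (hU : IsOpen U) {c : ℝ} (hc : c ∈ W)
    (hc0 : c ≠ 0) {z : Base} (hz : z ∈ U) (q s : ℝ)
    (hℓ : grad φ.base z 1 1 + s * grad φ.base z 1 3 ≠ 0) :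
    ∃ R, ∀ p r w y, prolong φ.base (jet z p q r s w y) 10 =
      (R + w * (grad φ.base z 2 2 / (grad φ.base z 1 1 + s * grad φ.base z 1 3)) +
        y * ((grad φ.base z 2 3 * (grad φ.base z 1 1 + s * grad φ.base z 1 3) -
          (grad φ.base z 2 1 + q * grad φ.base z 2 2 + s * grad φ.base z 2 3) *
            grad φ.base z 1 3) / (grad φ.base z 1 1 + s * grad φ.base z 1 3) ^ 2)) /
      (grad φ.base z 1 1 + s * grad φ.base z 1 3) := by
  -- `B` is the new u_x as a function of the point, u_x and h_x. Applying D_x once more, u_xx and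
  -- h_xx enter linearly through the last two directions, and `R` is the derivative along the rest.
  let B : Base × ℝ × ℝ → ℝ := fun ζ =>
    (grad φ.base ζ.1 2 1 + ζ.2.1 * grad φ.base ζ.1 2 2 + ζ.2.2 * grad φ.base ζ.1 2 3) /
      (grad φ.base ζ.1 1 1 + ζ.2.2 * grad φ.base ζ.1 1 3)
  have hg : ∀ i k, DifferentiableAt ℝ (fun ζ : Base × ℝ × ℝ => grad φ.base ζ.1 i k) (z, q, s) :=
    fun i k => ((h.contDiffAt_grad hU hz i k).differentiableAt (by simp)).comp
      (f := Prod.fst) (z, q, s) differentiableAt_fst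
  have hB : DifferentiableAt ℝ B (z, q, s) := by
    have h1 := hg 2 1
    have h2 := hg 2 2
    have h3 := hg 2 3
    have h4 := hg 1 1
    have h5 := hg 1 3
    have hn : DifferentiableAt ℝ (fun ζ : Base × ℝ × ℝ => grad φ.base ζ.1 2 1 +
        ζ.2.1 * grad φ.base ζ.1 2 2 + ζ.2.2 * grad φ.base ζ.1 2 3) (z, q, s) := by fun_prop
    have hm : DifferentiableAt ℝ (fun ζ : Base × ℝ × ℝ => grad φ.base ζ.1 1 1 +
        ζ.2.2 * grad φ.base ζ.1 1 3) (z, q, s) := by fun_prop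
    have hm0 : (fun ζ : Base × ℝ × ℝ => grad φ.base ζ.1 1 1 +
        ζ.2.2 * grad φ.base ζ.1 1 3) (z, q, s) ≠ 0 := hℓ
    have := hn.fun_mul (hm.fun_inv hm0)
    simpa only [B, div_eq_mul_inv] using this
  have hq : fderiv ℝ B (z, q, s) (0, 1, 0) =
      grad φ.base z 2 2 / (grad φ.base z 1 1 + s * grad φ.base z 1 3) := by
    have h1 : HasDerivAt (fun t : ℝ => ((z, t, s) : Base × ℝ × ℝ)) (0, 1, 0) q :=
      (hasDerivAt_const q z).prodMk ((hasDerivAt_id q).prodMk (hasDerivAt_const q s))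
    have h2 := hB.hasFDerivAt.comp_hasDerivAt q h1
    have h3 : HasDerivAt (fun t : ℝ => B (z, t, s))
        (grad φ.base z 2 2 / (grad φ.base z 1 1 + s * grad φ.base z 1 3)) q := by
      simpa using ((((hasDerivAt_id q).mul_const (grad φ.base z 2 2)).const_add
        (grad φ.base z 2 1)).add_const (s * grad φ.base z 2 3)).div_const
          (grad φ.base z 1 1 + s * grad φ.base z 1 3)
    exact h2.unique h3
  have hs : fderiv ℝ B (z, q, s) (0, 0, 1) =
      (grad φ.base z 2 3 * (grad φ.base z 1 1 + s * grad φ.base z 1 3) -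
          (grad φ.base z 2 1 + q * grad φ.base z 2 2 + s * grad φ.base z 2 3) *
            grad φ.base z 1 3) / (grad φ.base z 1 1 + s * grad φ.base z 1 3) ^ 2 := by
    have h1 : HasDerivAt (fun t : ℝ => ((z, q, t) : Base × ℝ × ℝ)) (0, 0, 1) s :=
      (hasDerivAt_const s z).prodMk ((hasDerivAt_const s q).prodMk (hasDerivAt_id s))
    have h2 := hB.hasFDerivAt.comp_hasDerivAt s h1
    have h3 := (((hasDerivAt_id s).mul_const (grad φ.base z 2 3)).const_add
        (grad φ.base z 2 1 + q * grad φ.base z 2 2)).div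
          (((hasDerivAt_id s).mul_const (grad φ.base z 1 3)).const_add (grad φ.base z 1 1)) hℓ
    refine (h2.unique h3).trans ?_
    simp
  refine ⟨fderiv ℝ B (z, q, s) (![0, 1, q, s], 0, 0), fun p r w y => ?_⟩
  set j := jet z p q r s w y with hj
  have hjz : toBase j = z := toBase_jet ..
  let π : Jet →L[ℝ] Base × ℝ × ℝ := toBaseL.prod
    ((ContinuousLinearMap.proj (R := ℝ) (φ := fun _ : Fin 14 => ℝ) 5).prod
      (ContinuousLinearMap.proj (R := ℝ) (φ := fun _ : Fin 14 => ℝ) 7))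
  have hπ : ∀ j, π j = (toBase j, j 5, j 7) := fun j => by simp [π, toBaseL_apply]
  have hA : newX φ.base (comp φ.base 2) =ᶠ[𝓝 j] B ∘ π := by
    filter_upwards [continuous_toBase.continuousAt.eventually
      (hU.mem_nhds (show toBase j ∈ U by rwa [hjz]))] with j' hj'
    rw [h.newX_eq hS hU hc hc0 hj', totalX_comp (h.differentiableAt_base hU hj'),
      (h.grad_velocity hS hU hc hc0 hj').1]
    simp [B, hπ]
  have hπj : π j = (z, q, s) := by rw [hπ, hjz]; rfl
  change newX φ.base (newX φ.base (comp φ.base 2)) j = _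
  rw [h.newX_eq hS hU hc hc0 (by rwa [hjz]), (totalX_congr hA).eq_of_nhds, hjz,
    (h.grad_velocity hS hU hc hc0 hz).1, totalX,
    ((hπj.symm ▸ hB.hasFDerivAt : HasFDerivAt B _ (π j)).comp j π.hasFDerivAt).fderiv,
    ContinuousLinearMap.comp_apply, hπj, hπ, ← hq, ← hs]
  have hvec : ((![0, 1, q, s], w, y) : Base × ℝ × ℝ) =
      (![0, 1, q, s], 0, 0) + w • (0, 1, 0) + y • (0, 0, 1) := by simp
  have hvec' := congrArg (fderiv ℝ B (z, q, s)) hvec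
  rw [map_add, map_add, map_smul, map_smul, smul_eq_mul, smul_eq_mul] at hvec'
  rw [← hvec', mul_zero, add_zero]
  rfl

end IsEquivalenceTransformation

theorem exists_mem_notMem_of_isOpen {W : Set ℝ} (hW : IsOpen W) (hne : W.Nonempty) {s : Set ℝ}
    (hs : s.Finite) : ∃ c ∈ W, c ∉ s := by
  obtain ⟨c, hc, hc'⟩ := (hs.countable.dense_compl ℝ).inter_open_nonempty W hW hne
  exact ⟨c, hc, hc'⟩

/-! ### The momentum equation and the transformation of F -/

namespace IsEquivalenceTransformation

variable {S : Set ArbElem} {U : Set Base} {W : Set ℝ} {φ : Transf}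

theorem continuousAt_jac (h : IsEquivalenceTransformation S U W φ) (hU : IsOpen U) {j : Jet}
    (hj : toBase j ∈ U) : ContinuousAt (jac φ.base) j := by
  have hg : ∀ i k, ContinuousAt (fun j : Jet => grad φ.base (toBase j) i k) j := fun i k =>
    ContinuousAt.comp (f := toBase) (h.contDiffAt_grad hU hj i k).continuousAt
      continuous_toBase.continuousAt
  have hx : ∀ i, ContinuousAt (fun j : Jet => grad φ.base (toBase j) i 1 +
      j 5 * grad φ.base (toBase j) i 2 + j 7 * grad φ.base (toBase j) i 3) j := fun i =>
    ((hg i 1).add ((continuous_apply 5).continuousAt.mul (hg i 2))).add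
      ((continuous_apply 7).continuousAt.mul (hg i 3))
  have ht : ∀ i, ContinuousAt (fun j : Jet => grad φ.base (toBase j) i 0 +
      j 4 * grad φ.base (toBase j) i 2 + j 6 * grad φ.base (toBase j) i 3) j := fun i =>
    ((hg i 0).add ((continuous_apply 4).continuousAt.mul (hg i 2))).add
      ((continuous_apply 6).continuousAt.mul (hg i 3))
  refine (((ht 0).mul (hx 1)).sub ((hx 0).mul (ht 1))).congr ?_
  filter_upwards [continuous_toBase.continuousAt.eventually (hU.mem_nhds hj)] with j' hj'
  have hd := h.differentiableAt_base hU hj'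
  rw [jac, totalT_comp hd, totalT_comp hd, totalX_comp hd, totalX_comp hd]
  rfl

theorem isOpen_domain (h : IsEquivalenceTransformation S U W φ) (hU : IsOpen U) (hW : IsOpen W) :
    IsOpen (φ.domain U W) := by
  refine isOpen_iff_mem_nhds.2 fun m hm => ?_
  filter_upwards [(isOpen_cylinder hU hW).mem_nhds hm.1, continuous_fst.continuousAt.eventually
    ((h.continuousAt_jac hU hm.1.1).eventually_ne hm.2)] with m' h1 h2 using ⟨h1, h2⟩

/-- Otherwise the new F would vanish for all values of F near a nonzero point of `W`, against its
nonzero derivative in F. This permits cancelling the new F when coefficients of h_xx are compared.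
-/
theorem exists_arb_ne_zero (h : IsEquivalenceTransformation S U W φ) (hU : IsOpen U)
    (hW : IsOpen W) (hne : W.Nonempty) {j : Jet} (hj : toBase j ∈ U) (hjac : jac φ.base j ≠ 0) :
    ∃ c ∈ W, c ≠ 0 ∧ φ.arb (j, c) ≠ 0 := by
  by_contra! h0
  obtain ⟨c, hc, hc0⟩ := exists_mem_notMem_of_isOpen hW hne (Set.finite_singleton 0)
  have hm : ((j, c) : ExtJet) ∈ φ.domain U W := ⟨⟨hj, hc⟩, hjac⟩
  have hd : HasFDerivAt φ.arb (fderiv ℝ φ.arb (j, c)) (j, c) :=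
    ((h.smooth_arb.contDiffAt ((h.isOpen_domain hU hW).mem_nhds hm)).differentiableAt
      (by simp)).hasFDerivAt
  have h1 : HasDerivAt (fun t : ℝ => ((j, t) : ExtJet)) (0, 1) c :=
    (hasDerivAt_const c j).prodMk (hasDerivAt_id c)
  have h2 := hd.comp_hasDerivAt c h1
  have h3 : φ.arb ∘ (fun t : ℝ => ((j, t) : ExtJet)) =ᶠ[𝓝 c] fun _ => 0 := by
    filter_upwards [hW.mem_nhds hc, isOpen_ne.mem_nhds (show c ≠ 0 from hc0)] with t ht ht0
      using h0 t ht ht0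
  exact h.deriv_arb _ hm (h2.unique ((hasDerivAt_const c (0 : ℝ)).congr_of_eventuallyEq h3))

theorem args_prolong_eq (h : IsEquivalenceTransformation S U W φ)
    (hS : S = allElements ∨ S = nonvanishingElements) (hU : IsOpen U) {c : ℝ} (hc : c ∈ W)
    (hc0 : c ≠ 0) {j j' : Jet} (hj : toBase j ∈ U) (he : toBase j = toBase j')
    (h5 : j 5 = j' 5) (h7 : j 7 = j' 7) :
    args (prolong φ.base j) = args (prolong φ.base j') := by
  have hj' : toBase j' ∈ U := he ▸ hj
  rw [args_prolong, args_prolong, h.newX_eq hS hU hc hc0 hj, h.newX_eq hS hU hc hc0 hj,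
    h.newX_eq hS hU hc hc0 hj', h.newX_eq hS hU hc hc0 hj',
    totalX_comp (h.differentiableAt_base hU hj), totalX_comp (h.differentiableAt_base hU hj),
    totalX_comp (h.differentiableAt_base hU hj'), totalX_comp (h.differentiableAt_base hU hj'),
    comp, comp, he, h5, h7]

theorem prolong_two (g : Base → Base) (j : Jet) : prolong g j 2 = g (toBase j) 2 := rfl

theorem prolong_four (g : Base → Base) (j : Jet) : prolong g j 4 = newT g (comp g 2) j := rfl

theorem prolong_five (g : Base → Base) (j : Jet) : prolong g j 5 = newX g (comp g 2) j := rfl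

theorem prolong_seven (g : Base → Base) (j : Jet) : prolong g j 7 = newX g (comp g 3) j := rfl

theorem jet_apply (z : Base) (p q r s w y : ℝ) :
    jet z p q r s w y 2 = z 2 ∧ jet z p q r s w y 3 = z 3 ∧ jet z p q r s w y 4 = p ∧
    jet z p q r s w y 5 = q ∧ jet z p q r s w y 6 = r ∧ jet z p q r s w y 7 = s ∧
    jet z p q r s w y 10 = w :=
  ⟨rfl, rfl, rfl, rfl, rfl, rfl, rfl⟩

/-- The transformed momentum equation, in terms of the original variables. -/
theorem exists_momentum_eq (h : IsEquivalenceTransformation S U W φ)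
    (hS : S = allElements ∨ S = nonvanishingElements) (hU : IsOpen U) {c : ℝ} (hc : c ∈ W)
    (hc0 : c ≠ 0) {z : Base} (hz : z ∈ U) {q s : ℝ}
    (hℓ : grad φ.base z 1 1 + s * grad φ.base z 1 3 ≠ 0) :
    ∃ F, (∀ j, toBase j = z → j 5 = q → j 7 = s → φ.arb (j, c) = F) ∧
      ∀ p w y, p + z 2 * q + s - c * w = 0 →
        ((grad φ.base z 1 1 + s * grad φ.base z 1 3) *
            (grad φ.base z 2 0 + p * grad φ.base z 2 2 -
              (z 2 * s + z 3 * q) * grad φ.base z 2 3) -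
          (grad φ.base z 1 0 - (z 2 * s + z 3 * q) * grad φ.base z 1 3) *
            (grad φ.base z 2 1 + q * grad φ.base z 2 2 + s * grad φ.base z 2 3)) /
          (grad φ.base z 0 0 * (grad φ.base z 1 1 + s * grad φ.base z 1 3)) +
        φ.base z 2 * ((grad φ.base z 2 1 + q * grad φ.base z 2 2 + s * grad φ.base z 2 3) /
          (grad φ.base z 1 1 + s * grad φ.base z 1 3)) +
        (grad φ.base z 3 1 + s * grad φ.base z 3 3) /
          (grad φ.base z 1 1 + s * grad φ.base z 1 3) -
        F * prolong φ.base (jet z p q (-(z 2 * s + z 3 * q)) s w y) 10 = 0 := by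
  obtain ⟨f, hf⟩ := h.exists_arb_eq hS hc hc0
  obtain ⟨h12, h32⟩ := h.grad_velocity hS hU hc hc0 hz
  have hjac : ∀ j, toBase j = z → j 7 = s → jac φ.base j ≠ 0 := fun j hj h7 => by
    rw [h.jac_eq hS hU hc hc0 (hj.symm ▸ hz), hj, h7, h12, mul_zero, add_zero]
    exact mul_ne_zero (h.grad_time_ne_zero hS hU hc hc0 hz) hℓ
  -- The new arguments depend only on z, u_x and h_x, so any jet with these values serves as a
  -- reference.
  refine ⟨f (args (prolong φ.base (jet z 0 q 0 s 0 0))), fun j hj h5 h7 => ?_,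
    fun p w y hp => ?_⟩
  · rw [(hf j (hj.symm ▸ hz) (hjac j hj h7)).1, h.args_prolong_eq hS hU hc hc0 (hj.symm ▸ hz)
      (hj.trans (toBase_jet ..).symm) h5 h7]
  · have hjz : toBase (jet z p q (-(z 2 * s + z 3 * q)) s w y) = z := toBase_jet ..
    obtain ⟨j2, j3, j4, j5, j6, j7, j10⟩ := jet_apply z p q (-(z 2 * s + z 3 * q)) s w y
    obtain ⟨-, -, -, i5, -, i7, -⟩ := jet_apply z 0 q 0 s 0 0
    have e := ((hf _ (hjz.symm ▸ hz) (hjac _ hjz j7)).2 (by rw [j2, j4, j5, j7, j10, hp])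
      (by rw [j2, j3, j5, j6, j7]; ring)).1
    rw [h.args_prolong_eq hS hU hc hc0 (hjz.symm ▸ hz) (j' := jet z 0 q 0 s 0 0)
      (hjz.trans (toBase_jet ..).symm) (j5.trans i5.symm) (j7.trans i7.symm), prolong_two,
      prolong_four, prolong_five, prolong_seven, hjz, h.newT_comp_jet hS hU hc hc0 hz,
      h.newX_comp_jet hS hU hc hc0 hz, h.newX_comp_jet hS hU hc hc0 hz, h12, h32] at e
    simpa only [mul_zero, add_zero, neg_mul, ← sub_eq_add_neg] using e

/-- The new space variable and the new velocity do not depend on the height. -/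
theorem grad_height (h : IsEquivalenceTransformation S U W φ)
    (hS : S = allElements ∨ S = nonvanishingElements) (hU : IsOpen U) (hW : IsOpen W)
    (hne : W.Nonempty) {z : Base} (hz : z ∈ U) :
    grad φ.base z 1 3 = 0 ∧ grad φ.base z 2 3 = 0 ∧ grad φ.base z 1 1 ≠ 0 := by
  obtain ⟨c₀, hc₀, hc₀0⟩ := exists_mem_notMem_of_isOpen hW hne (Set.finite_singleton 0)
  obtain ⟨h12, h32⟩ := h.grad_velocity hS hU hc₀ hc₀0 hz
  have h22 := h.grad_velocity_ne_zero hS hU hc₀ hc₀0 hz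
  obtain ⟨q₀, s₀, h₀⟩ := h.exists_grad_space_ne_zero hS hU hc₀ hc₀0 hz
  rw [h12, mul_zero, add_zero] at h₀
  have key : ∀ q s : ℝ, grad φ.base z 1 1 + s * grad φ.base z 1 3 ≠ 0 →
      grad φ.base z 2 3 * (grad φ.base z 1 1 + s * grad φ.base z 1 3) -
        (grad φ.base z 2 1 + q * grad φ.base z 2 2 + s * grad φ.base z 2 3) *
          grad φ.base z 1 3 = 0 := by
    intro q s hℓ
    obtain ⟨c, hc, hc0, harb⟩ := h.exists_arb_ne_zero hU hW hne (j := jet z 0 q 0 s 0 0)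
      (by rwa [toBase_jet]) (by
        rw [h.jac_eq hS hU hc₀ hc₀0 (by rwa [toBase_jet]), toBase_jet, h12, mul_zero, add_zero]
        exact mul_ne_zero (h.grad_time_ne_zero hS hU hc₀ hc₀0 hz) hℓ)
    obtain ⟨F, hF, hm⟩ := h.exists_momentum_eq hS hU hc hc0 hz (q := q) hℓ
    rw [hF _ (toBase_jet ..) (jet_apply ..).2.2.2.1 (jet_apply ..).2.2.2.2.2.1] at harb
    obtain ⟨R, hR⟩ := h.exists_prolong_jet_ten hS hU hc hc0 hz q s hℓ
    -- With u_t = 0, this u_xx solves the momentum equation. Changing h_xx from 0 to 1 stays inside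
    -- the system, so its coefficient in the new u_xx must vanish.
    have hw : 0 + z 2 * q + s - c * ((z 2 * q + s) / c) = 0 := by field_simp; ring
    have e0 := hm _ _ 0 hw
    have e1 := hm _ _ 1 hw
    rw [hR] at e0 e1
    have e2 := e0.trans e1.symm
    rw [sub_right_inj, mul_right_inj' harb, div_left_inj' hℓ, add_right_inj, zero_mul, one_mul,
      eq_comm, div_eq_zero_iff] at e2
    exact e2.resolve_right (pow_ne_zero 2 hℓ)
  have all := eq_zero_of_analytic (E := ℝ × ℝ) (v₀ := (q₀, s₀))
    (f := fun v => grad φ.base z 2 3 * (grad φ.base z 1 1 + v.2 * grad φ.base z 1 3) -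
        (grad φ.base z 2 1 + v.1 * grad φ.base z 2 2 + v.2 * grad φ.base z 2 3) *
          grad φ.base z 1 3)
    (J := fun v => grad φ.base z 1 1 + v.2 * grad φ.base z 1 3)
    (by fun_prop) (by fun_prop) h₀ fun v hv => key _ _ hv
  -- The relation is affine in q with slope `-(grad φ.base z 2 2 * grad φ.base z 1 3)`.
  have h13 : grad φ.base z 1 3 = 0 := by
    have e0 := all (0, 0)
    have e1 := all (1, 0)
    simp only at e0 e1
    exact (mul_eq_zero.1 (by linear_combination e0 - e1 :
      grad φ.base z 2 2 * grad φ.base z 1 3 = 0)).resolve_left h22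
  rw [h13, mul_zero, add_zero] at h₀
  refine ⟨h13, ?_, h₀⟩
  have e0 := all (0, 0)
  simp only [h13, mul_zero, add_zero, sub_zero] at e0
  exact (mul_eq_zero.1 e0).resolve_right h₀

/-- The transformation of the arbitrary element, and the momentum equation at `u_xx = 0`. -/
theorem arb_eq_and_momentum (h : IsEquivalenceTransformation S U W φ)
    (hS : S = allElements ∨ S = nonvanishingElements) (hU : IsOpen U) (hW : IsOpen W)
    (hne : W.Nonempty) {z : Base} (hz : z ∈ U) (q s : ℝ) :
    (∀ c ∈ W, c ≠ 0 → ∀ j, toBase j = z → j 5 = q → j 7 = s →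
      φ.arb (j, c) = c * grad φ.base z 1 1 ^ 2 / grad φ.base z 0 0) ∧
    grad φ.base z 1 1 * (grad φ.base z 2 0 - (z 2 * q + s) * grad φ.base z 2 2) -
      grad φ.base z 1 0 * (grad φ.base z 2 1 + q * grad φ.base z 2 2) +
      grad φ.base z 0 0 * (φ.base z 2 * (grad φ.base z 2 1 + q * grad φ.base z 2 2) +
        (grad φ.base z 3 1 + s * grad φ.base z 3 3)) = 0 := by
  -- Two distinct nonzero values of F are needed: the remaining equation equates an expression free
  -- of c with c times one free of c, so both vanish.
  obtain ⟨c₁, hc₁, hc₁0⟩ := exists_mem_notMem_of_isOpen hW hne (Set.finite_singleton 0)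
  obtain ⟨c₂, hc₂, hc₂'⟩ := exists_mem_notMem_of_isOpen hW hne (Set.toFinite {0, c₁})
  simp only [Set.mem_insert_iff, Set.mem_singleton_iff, not_or] at hc₂' hc₁0
  obtain ⟨hc₂0, hc₁₂⟩ := hc₂'
  obtain ⟨h13, h23, h11⟩ := h.grad_height hS hU hW hne hz
  have h22 := h.grad_velocity_ne_zero hS hU hc₁ hc₁0 hz
  have h00 := h.grad_time_ne_zero hS hU hc₁ hc₁0 hz
  have hℓ : grad φ.base z 1 1 + s * grad φ.base z 1 3 ≠ 0 := by
    rwa [h13, mul_zero, add_zero]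
  obtain ⟨R, hR⟩ := h.exists_prolong_jet_ten hS hU hc₁ hc₁0 hz q s hℓ
  have key : ∀ c ∈ W, c ≠ 0 → (∀ j, toBase j = z → j 5 = q → j 7 = s →
      φ.arb (j, c) = c * grad φ.base z 1 1 ^ 2 / grad φ.base z 0 0) ∧
    grad φ.base z 1 1 * (grad φ.base z 2 0 - (z 2 * q + s) * grad φ.base z 2 2) -
      grad φ.base z 1 0 * (grad φ.base z 2 1 + q * grad φ.base z 2 2) +
      grad φ.base z 0 0 * (φ.base z 2 * (grad φ.base z 2 1 + q * grad φ.base z 2 2) +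
        (grad φ.base z 3 1 + s * grad φ.base z 3 3)) = c * (R * grad φ.base z 1 1 ^ 2) := by
    intro c hc hc0
    obtain ⟨F, hF, hm⟩ := h.exists_momentum_eq hS hU hc hc0 hz (q := q) hℓ
    -- Raising u_xx from 0 to 1 is balanced by raising u_t by c; comparing the two jets determines
    -- the new F.
    have e0 := hm (-(z 2 * q + s)) 0 0 (by ring)
    have e1 := hm (c - (z 2 * q + s)) 1 0 (by ring)
    rw [hR, h13, h23] at e0 e1
    simp only [mul_zero, add_zero, sub_zero, zero_mul, one_mul] at e0 e1
    set a := grad φ.base z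
    have hFe : F = c * a 1 1 ^ 2 / a 0 0 := by
      field_simp at e0 e1 ⊢
      have : a 2 2 * (F * a 0 0 - c * a 1 1 ^ 2) = 0 := by linear_combination a 1 1 * e0 - e1
      linear_combination (mul_eq_zero.1 this).resolve_left h22
    refine ⟨fun j hj h5 h7 => (hF j hj h5 h7).trans hFe, ?_⟩
    rw [hFe] at e0
    field_simp at e0
    linear_combination e0
  have k1 := (key c₁ hc₁ hc₁0).2
  have k2 := (key c₂ hc₂ hc₂0).2
  refine ⟨fun c hc hc0 => (key c hc hc0).1, k1.trans ?_⟩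
  have : (c₂ - c₁) * (R * grad φ.base z 1 1 ^ 2) = 0 := by linear_combination k1 - k2
  rw [(mul_eq_zero.1 this).resolve_left (sub_ne_zero.2 hc₁₂), mul_zero]

end IsEquivalenceTransformation

/-! ### Calculus of partial derivatives -/

/-- `f` is differentiable at `z`, with partial derivative `f'` in the `k`-th direction. -/
def HasPD (k : Fin 4) (f : Base → ℝ) (f' : ℝ) (z : Base) : Prop :=
  DifferentiableAt ℝ f z ∧ pd k f z = f'

namespace HasPD

variable {k : Fin 4} {f g : Base → ℝ} {f' g' : ℝ} {z : Base}

theorem of_contDiffAt (hf : ContDiffAt ℝ ∞ f z) (h : pd k f z = f') : HasPD k f f' z :=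
  ⟨hf.differentiableAt (by simp), h⟩

theorem add (hf : HasPD k f f' z) (hg : HasPD k g g' z) :
    HasPD k (fun z => f z + g z) (f' + g') z :=
  ⟨hf.1.fun_add hg.1, by rw [pd, fderiv_fun_add hf.1 hg.1, ← hf.2, ← hg.2]; rfl⟩

theorem sub (hf : HasPD k f f' z) (hg : HasPD k g g' z) :
    HasPD k (fun z => f z - g z) (f' - g') z :=
  ⟨hf.1.fun_sub hg.1, by rw [pd, fderiv_fun_sub hf.1 hg.1, ← hf.2, ← hg.2]; rfl⟩

theorem mul (hf : HasPD k f f' z) (hg : HasPD k g g' z) :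
    HasPD k (fun z => f z * g z) (f z * g' + g z * f') z :=
  ⟨hf.1.fun_mul hg.1, by rw [pd, fderiv_fun_mul hf.1 hg.1, ← hf.2, ← hg.2]; rfl⟩

theorem const (k : Fin 4) (c : ℝ) (z : Base) : HasPD k (fun _ => c) 0 z :=
  ⟨differentiableAt_const c, by simp [pd]⟩

theorem coord (k i : Fin 4) (z : Base) :
    HasPD k (fun z => z i) ((Pi.single k 1 : Base) i) z :=
  ⟨differentiableAt_apply i z, by
    rw [pd, (hasFDerivAt_apply (𝕜 := ℝ) (F' := fun _ : Fin 4 => ℝ) i z).fderiv]; rfl⟩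

theorem unique_of_eqOn {U : Set Base} (hf : HasPD k f f' z) (hg : HasPD k g g' z) (hU : IsOpen U)
    (hz : z ∈ U) (h : ∀ z ∈ U, f z = g z) : f' = g' := by
  have : f =ᶠ[𝓝 z] g := by filter_upwards [hU.mem_nhds hz] with z' hz' using h z' hz'
  rw [← hf.2, ← hg.2, pd, pd, this.fderiv_eq]

end HasPD

theorem pd_comm {f : Base → ℝ} {z : Base} (hf : ContDiffAt ℝ ∞ f z) (k l : Fin 4) :
    pd k (pd l f) z = pd l (pd k f) z := by
  have hd : DifferentiableAt ℝ (fderiv ℝ f) z :=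
    (hf.fderiv_right (m := ∞) (by simp)).differentiableAt (by simp)
  have key : ∀ k l : Fin 4, pd k (pd l f) z =
      fderiv ℝ (fderiv ℝ f) z (Pi.single k 1) (Pi.single l 1) := fun k l => by
    change fderiv ℝ (fun z => fderiv ℝ f z (Pi.single l 1)) z _ = _
    rw [fderiv_clm_apply hd (differentiableAt_const _)]
    simp
  rw [key, key]
  exact ((contDiffAt_infty.1 hf 2).isSymmSndFDerivAt (by simp)).eq _ _

theorem pd_pd_eq_zero {U : Set Base} (hU : IsOpen U) {f : Base → ℝ} {k : Fin 4}
    (hf : ∀ z ∈ U, ContDiffAt ℝ ∞ f z) (h0 : ∀ z ∈ U, pd k f z = 0) (l : Fin 4) :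
    ∀ z ∈ U, pd k (pd l f) z = 0 := fun z hz => by
  rw [pd_comm (hf z hz)]
  exact (HasPD.of_contDiffAt (contDiffAt_pd (hf z hz) k) rfl).unique_of_eqOn
    (HasPD.const l 0 z) hU hz h0

theorem exists_const_of_pd_eq_zero {U : Set Base} (hU : IsOpen U) (hUc : IsConnected U)
    {f : Base → ℝ} (hf : ∀ z ∈ U, ∀ k, HasPD k f 0 z) : ∃ c, ∀ z ∈ U, f z = c := by
  obtain ⟨z₀, hz₀⟩ := hUc.nonempty
  refine ⟨f z₀, fun z hz => hU.is_const_of_fderiv_eq_zero hUc.isPreconnected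
    (fun z hz => (hf z hz 0).1.differentiableWithinAt) (fun z hz => ?_) hz hz₀⟩
  ext v
  rw [fderiv_eq_sum_pd, (hf z hz 0).2, (hf z hz 1).2, (hf z hz 2).2, (hf z hz 3).2]
  simp

/-! ### Determining equations and their solution -/

namespace IsEquivalenceTransformation

variable {S : Set ArbElem} {U : Set Base} {W : Set ℝ} {φ : Transf}

/-- The first-order determining equations of the equivalence transformations. -/
theorem first_order (h : IsEquivalenceTransformation S U W φ)
    (hS : S = allElements ∨ S = nonvanishingElements) (hU : IsOpen U) (hW : IsOpen W)
    (hne : W.Nonempty) {z : Base} (hz : z ∈ U) :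
    grad φ.base z 0 0 * φ.base z 2 = z 2 * grad φ.base z 1 1 + grad φ.base z 1 0 ∧
    grad φ.base z 0 0 * (grad φ.base z 0 0 * φ.base z 3) =
      z 3 * (grad φ.base z 1 1 * grad φ.base z 1 1) ∧
    grad φ.base z 1 1 * grad φ.base z 2 0 + grad φ.base z 1 1 * z 2 * grad φ.base z 2 1 +
      grad φ.base z 0 0 * grad φ.base z 3 1 = 0 ∧
    grad φ.base z 1 1 * grad φ.base z 3 0 + grad φ.base z 1 1 * z 2 * grad φ.base z 3 1 +
      grad φ.base z 0 0 * φ.base z 3 * grad φ.base z 2 1 = 0 := by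
  obtain ⟨c, hc, hc0⟩ := exists_mem_notMem_of_isOpen hW hne (Set.finite_singleton 0)
  obtain ⟨h13, h23, h11⟩ := h.grad_height hS hU hW hne hz
  have h22 := h.grad_velocity_ne_zero hS hU hc hc0 hz
  have h00 := h.grad_time_ne_zero hS hU hc hc0 hz
  obtain ⟨h12, h32⟩ := h.grad_velocity hS hU hc hc0 hz
  have M := fun q s => (h.arb_eq_and_momentum hS hU hW hne hz q s).2
  have E := fun q s => h.mass_eq hS hU hc hc0 hz 0 q s
  simp only [h12, h13, h32, h23] at E
  set a := grad φ.base z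
  have m0 := M 0 0
  have m1 := M 1 0
  have m2 := M 0 1
  have e0 := E 0 0
  have e1 := E 1 0
  -- This is the u_x-coefficient of the momentum equation after removing the factor u'_u.
  have f1 : a 0 0 * φ.base z 2 = z 2 * a 1 1 + a 1 0 := by
    refine mul_left_cancel₀ h22 ?_
    linear_combination m1 - m0
  refine ⟨f1, ?_, ?_, ?_⟩
  -- The u_x-coefficient of mass conservation and the h_x-coefficient of momentum combine to
  -- eliminate h'_h.
  · refine mul_left_cancel₀ h22 ?_
    linear_combination a 0 0 * (e1 - e0) + a 1 1 * z 3 * (m2 - m0)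
  · linear_combination m0 - a 2 1 * f1
  · linear_combination e0 - a 3 1 * f1

/-- Write τ = t'_t, a = x'_x, κ = x'_t, and U, H for the new u, h. The relations τU = ua + κ and τ²H
= ha² turn the other two equations of `first_order` into differential equations for τ, a, κ. These
functions are independent of u and h, so the explicit u and h can be split off by differentiation.
-/
theorem second_order (h : IsEquivalenceTransformation S U W φ)
    (hS : S = allElements ∨ S = nonvanishingElements) (hU : IsOpen U) (hW : IsOpen W)
    (hne : W.Nonempty) :
    ∀ z ∈ U, ∀ k, HasPD k (fun z => grad φ.base z 0 0) 0 z ∧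
      HasPD k (fun z => grad φ.base z 1 1) 0 z ∧ HasPD k (fun z => grad φ.base z 1 0) 0 z := by
  obtain ⟨c, hc, hc0⟩ := exists_mem_notMem_of_isOpen hW hne (Set.finite_singleton 0)
  have hT : ∀ k, k ≠ 0 → ∀ z ∈ U, pd k (fun z => φ.base z 0) z = 0 := fun k hk z hz => by
    obtain ⟨h1, h2, h3⟩ := h.grad_time hS hU hc hc0 hz
    fin_cases k
    exacts [absurd rfl hk, h1, h2, h3]
  have hX : ∀ k, k = 2 ∨ k = 3 → ∀ z ∈ U, pd k (fun z => φ.base z 1) z = 0 := by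
    rintro k (rfl | rfl) z hz
    exacts [(h.grad_velocity hS hU hc hc0 hz).1, (h.grad_height hS hU hW hne hz).1]
  set τ : Base → ℝ := fun z => grad φ.base z 0 0
  set a : Base → ℝ := fun z => grad φ.base z 1 1
  set κ : Base → ℝ := fun z => grad φ.base z 1 0
  have cU := fun z (hz : z ∈ U) => h.contDiffAt_coord hU hz
  have cτ : ∀ z ∈ U, ContDiffAt ℝ ∞ τ z := fun z hz => h.contDiffAt_grad hU hz 0 0
  have ca : ∀ z ∈ U, ContDiffAt ℝ ∞ a z := fun z hz => h.contDiffAt_grad hU hz 1 1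
  have cκ : ∀ z ∈ U, ContDiffAt ℝ ∞ κ z := fun z hz => h.contDiffAt_grad hU hz 1 0
  have τk : ∀ k, k ≠ 0 → ∀ z ∈ U, pd k τ z = 0 := fun k hk =>
    pd_pd_eq_zero hU (fun z hz => cU z hz 0) (hT k hk) 0
  have ak : ∀ k, k = 2 ∨ k = 3 → ∀ z ∈ U, pd k a z = 0 := fun k hk =>
    pd_pd_eq_zero hU (fun z hz => cU z hz 1) (hX k hk) 1
  have κk : ∀ k, k = 2 ∨ k = 3 → ∀ z ∈ U, pd k κ z = 0 := fun k hk =>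
    pd_pd_eq_zero hU (fun z hz => cU z hz 1) (hX k hk) 0
  have κx : ∀ z ∈ U, pd 1 κ z = pd 0 a z := fun z hz => pd_comm (cU z hz 1) 1 0
  have τ0 : ∀ z ∈ U, τ z ≠ 0 := fun z hz => h.grad_time_ne_zero hS hU hc hc0 hz
  have a0 : ∀ z ∈ U, a z ≠ 0 := fun z hz => (h.grad_height hS hU hW hne hz).2.2
  have F := fun z (hz : z ∈ U) => h.first_order hS hU hW hne hz
  have Dτ := fun k z (hz : z ∈ U) => HasPD.of_contDiffAt (k := k) (cτ z hz) rfl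
  have Da := fun k z (hz : z ∈ U) => HasPD.of_contDiffAt (k := k) (ca z hz) rfl
  have Dκ := fun k z (hz : z ∈ U) => HasPD.of_contDiffAt (k := k) (cκ z hz) rfl
  have DU := fun k z (hz : z ∈ U) => HasPD.of_contDiffAt (k := k) (cU z hz 2) rfl
  have DH := fun k z (hz : z ∈ U) => HasPD.of_contDiffAt (k := k) (cU z hz 3) rfl
  have D1 := fun k z (hz : z ∈ U) => ((Dτ k z hz).mul (DU k z hz)).unique_of_eqOn
    (((HasPD.coord k 2 z).mul (Da k z hz)).add (Dκ k z hz)) hU hz fun z hz => (F z hz).1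
  have D2 := fun k z (hz : z ∈ U) => ((Dτ k z hz).mul ((Dτ k z hz).mul (DH k z hz))).unique_of_eqOn
    ((HasPD.coord k 3 z).mul ((Da k z hz).mul (Da k z hz))) hU hz fun z hz => (F z hz).2.1
  -- The third equation of `first_order`, with the derivatives of U and H eliminated, becomes 2u a_t
  -- + κ_t - τ_t U + (u² + 2h) a_x = 0.
  have e : ∀ z ∈ U, z 2 * pd 0 a z + pd 0 κ z - pd 0 τ z * φ.base z 2 +
      z 2 * z 2 * pd 1 a z + z 2 * pd 0 a z + 2 * z 3 * pd 1 a z = 0 := by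
    intro z hz
    have F3 : a z * pd 0 (fun z => φ.base z 2) z + a z * z 2 * pd 1 (fun z => φ.base z 2) z +
      τ z * pd 1 (fun z => φ.base z 3) z = 0 := (F z hz).2.2.1
    have d0 := D1 0 z hz
    have d1 := D1 1 z hz
    have d2 := D2 1 z hz
    rw [τk 1 (by decide) z hz] at d1 d2
    rw [κx z hz] at d1
    simp at d0 d1 d2
    refine mul_left_cancel₀ (a0 z hz) ?_
    linear_combination τ z * F3 - a z * d0 - a z * z 2 * d1 - d2
  have e2 : ∀ k : Fin 4, k = 2 ∨ k = 3 → ∀ z (hz : z ∈ U), _ := fun k hk z hz =>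
    (((((((HasPD.coord k 2 z).mul (HasPD.of_contDiffAt (contDiffAt_pd (ca z hz) 0)
      (pd_pd_eq_zero hU ca (ak k hk) 0 z hz))).add
      (HasPD.of_contDiffAt (contDiffAt_pd (cκ z hz) 0)
      (pd_pd_eq_zero hU cκ (κk k hk) 0 z hz))).sub
      ((HasPD.of_contDiffAt (contDiffAt_pd (cτ z hz) 0)
      (pd_pd_eq_zero hU cτ (τk k (by rintro rfl; simp at hk)) 0 z hz)).mul (DU k z hz))).add
      (((HasPD.coord k 2 z).mul (HasPD.coord k 2 z)).mul
        (HasPD.of_contDiffAt (contDiffAt_pd (ca z hz) 1)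
      (pd_pd_eq_zero hU ca (ak k hk) 1 z hz)))).add
      ((HasPD.coord k 2 z).mul (HasPD.of_contDiffAt (contDiffAt_pd (ca z hz) 0)
      (pd_pd_eq_zero hU ca (ak k hk) 0 z hz)))).add
      (((HasPD.const k 2 z).mul (HasPD.coord k 3 z)).mul
        (HasPD.of_contDiffAt (contDiffAt_pd (ca z hz) 1)
      (pd_pd_eq_zero hU ca (ak k hk) 1 z hz)))).unique_of_eqOn (HasPD.const k 0 z) hU hz e
  -- As U does not depend on h, the h-derivative of `e` is 2a_x = 0.
  have ax : ∀ z ∈ U, pd 1 a z = 0 := by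
    intro z hz
    have h1 := e2 3 (Or.inr rfl) z hz
    have h2 : pd 3 (fun z => φ.base z 2) z = 0 := (h.grad_height hS hU hW hne hz).2.1
    rw [h2] at h1
    simpa using h1
  -- The u-derivative of `e` is 2a_t = τ_t U_u, and τU_u = a.
  have aτ : ∀ z ∈ U, 2 * τ z * pd 0 a z = pd 0 τ z * a z := by
    intro z hz
    have h1 := e2 2 (Or.inl rfl) z hz
    have h2 := D1 2 z hz
    rw [τk 2 (by decide) z hz, ak 2 (Or.inl rfl) z hz, κk 2 (Or.inl rfl) z hz] at h2
    simp [ax z hz] at h1 h2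
    linear_combination τ z * h1 + pd 0 τ z * h2
  have hat : ∀ z ∈ U, z 3 * pd 0 a z = 0 := by
    intro z hz
    have F4 : a z * pd 0 (fun z => φ.base z 3) z + a z * z 2 * pd 1 (fun z => φ.base z 3) z +
      τ z * φ.base z 3 * pd 1 (fun z => φ.base z 2) z = 0 := (F z hz).2.2.2
    have F2 := (F z hz).2.1
    have d0 := D2 0 z hz
    have d1 := D1 1 z hz
    have d2 := D2 1 z hz
    rw [τk 1 (by decide) z hz, ax z hz] at d1 d2
    rw [κx z hz] at d1
    simp [τ0 z hz] at d0 d1 d2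
    have h3 := aτ z hz
    -- Now H_x = 0 and τU_x = a_t, so the fourth equation reads aH_t + Ha_t = 0. Inserting τ²H = ha²
    -- and 2τa_t = τ_t a leaves a multiple of h a_t.
    refine mul_left_cancel₀ (mul_ne_zero (pow_ne_zero 2 (a0 z hz)) (τ0 z hz)) ?_
    rw [d2] at F4
    linear_combination a z * τ z * d0 - τ z ^ 3 * F4 + τ z ^ 3 * φ.base z 3 * d1 +
      (τ z * pd 0 a z - 2 * a z * pd 0 τ z) * F2 + 2 * a z ^ 2 * z 3 * h3
  -- `U` may contain points with h = 0, so the relation h a_t = 0 is differentiated in h instead of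
  -- divided by h.
  have at0 : ∀ z ∈ U, pd 0 a z = 0 := by
    intro z hz
    have := ((HasPD.coord 3 3 z).mul (HasPD.of_contDiffAt (contDiffAt_pd (ca z hz) 0)
      (pd_pd_eq_zero hU ca (ak 3 (Or.inr rfl)) 0 z hz))).unique_of_eqOn (HasPD.const 3 0 z) hU hz hat
    simpa using this
  have τt : ∀ z ∈ U, pd 0 τ z = 0 := by
    intro z hz
    have := aτ z hz
    rw [at0 z hz, mul_zero, eq_comm] at this
    exact (mul_eq_zero.1 this).resolve_right (a0 z hz)
  have κt : ∀ z ∈ U, pd 0 κ z = 0 := by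
    intro z hz
    have := e z hz
    rw [at0 z hz, τt z hz, ax z hz] at this
    simpa using this
  intro z hz k
  refine ⟨HasPD.of_contDiffAt (cτ z hz) ?_, HasPD.of_contDiffAt (ca z hz) ?_,
    HasPD.of_contDiffAt (cκ z hz) ?_⟩
  · fin_cases k
    exacts [τt z hz, τk 1 (by decide) z hz, τk 2 (by decide) z hz, τk 3 (by decide) z hz]
  · fin_cases k
    exacts [at0 z hz, ax z hz, ak 2 (Or.inl rfl) z hz, ak 3 (Or.inr rfl) z hz]
  · fin_cases k
    exacts [κt z hz, (κx z hz).trans (at0 z hz), κk 2 (Or.inl rfl) z hz, κk 3 (Or.inr rfl) z hz]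

/-- An equivalence transformation acts as a similarity. -/
theorem exists_similarity (h : IsEquivalenceTransformation S U W φ)
    (hS : S = allElements ∨ S = nonvanishingElements) (hU : IsOpen U) (hUc : IsConnected U)
    (hW : IsOpen W) (hne : W.Nonempty) : ∃ τ b k t₀ x₀ : ℝ, τ ≠ 0 ∧ b ≠ 0 ∧
      (∀ z ∈ U, φ.base z = similarityBase τ b k t₀ x₀ z) ∧
      ∀ m ∈ φ.domain U W, φ.arb m = τ * b ^ 2 * m.2 := by
  obtain ⟨c, hc, hc0⟩ := exists_mem_notMem_of_isOpen hW hne (Set.finite_singleton 0)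
  have hs := h.second_order hS hU hW hne
  obtain ⟨τ, hτ⟩ := exists_const_of_pd_eq_zero hU hUc fun z hz k => (hs z hz k).1
  obtain ⟨a, ha⟩ := exists_const_of_pd_eq_zero hU hUc fun z hz k => (hs z hz k).2.1
  obtain ⟨κ, hκ⟩ := exists_const_of_pd_eq_zero hU hUc fun z hz k => (hs z hz k).2.2
  have D := fun i k z (hz : z ∈ U) =>
    HasPD.of_contDiffAt (k := k) (h.contDiffAt_coord hU hz i) rfl
  obtain ⟨t₀, ht₀⟩ := exists_const_of_pd_eq_zero hU hUc (f := fun z => φ.base z 0 - τ * z 0)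
    fun z hz k => by
      obtain ⟨h1, h2, h3⟩ := h.grad_time hS hU hc hc0 hz
      have := (D 0 k z hz).sub ((HasPD.const k τ z).mul (HasPD.coord k 0 z))
      convert this using 1
      change 0 = grad φ.base z 0 k - _
      have h0 := hτ z hz
      fin_cases k <;> simp [h0, h1, h2, h3]
  obtain ⟨x₀, hx₀⟩ := exists_const_of_pd_eq_zero hU hUc
    (f := fun z => φ.base z 1 - (a * z 1 + κ * z 0))
    fun z hz k => by
      have h2 := (h.grad_velocity hS hU hc hc0 hz).1
      have h3 := (h.grad_height hS hU hW hne hz).1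
      have := (D 1 k z hz).sub (((HasPD.const k a z).mul (HasPD.coord k 1 z)).add
        ((HasPD.const k κ z).mul (HasPD.coord k 0 z)))
      convert this using 1
      change 0 = grad φ.base z 1 k - _
      have h0 := hκ z hz
      have h1 := ha z hz
      fin_cases k <;> simp [h0, h1, h2, h3]
  obtain ⟨z₀, hz₀⟩ := hUc.nonempty
  have hτ0 : τ ≠ 0 := hτ z₀ hz₀ ▸ h.grad_time_ne_zero hS hU hc hc0 hz₀
  have ha0 : a ≠ 0 := ha z₀ hz₀ ▸ (h.grad_height hS hU hW hne hz₀).2.2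
  -- In a similarity x'_x = τb and x'_t = τk, whence b and k.
  refine ⟨τ, a / τ, κ / τ, t₀, x₀, hτ0, div_ne_zero ha0 hτ0, fun z hz => ?_, ?_⟩
  · obtain ⟨f1, f2, -, -⟩ := h.first_order hS hU hW hne hz
    have e0 := ht₀ z hz
    have e1 := hx₀ z hz
    rw [hτ z hz, ha z hz] at f2
    rw [hτ z hz, ha z hz, hκ z hz] at f1
    funext i
    fin_cases i
    · simp [similarityBase]
      linear_combination e0
    · simp [similarityBase]
      field_simp
      linear_combination e1
    · simp [similarityBase]
      field_simp
      linear_combination f1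
    · simp [similarityBase]
      field_simp
      linear_combination f2
  · have harb : ∀ m ∈ φ.domain U W, m.2 ≠ 0 → φ.arb m = τ * (a / τ) ^ 2 * m.2 := by
      rintro ⟨j, c⟩ ⟨⟨hj, hc⟩, -⟩ hc0
      rw [(h.arb_eq_and_momentum hS hU hW hne hj _ _).1 c hc hc0 j rfl rfl rfl, ha _ hj, hτ _ hj]
      field_simp
    rintro ⟨j, c⟩ hm
    -- Constant elements were used only for c ≠ 0; the value at c = 0 follows from continuity of the
    -- F-component.
    rcases ne_or_eq c 0 with hc0 | rfl
    · exact harb _ hm hc0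
    have hcont : ContinuousAt (fun t : ℝ => φ.arb (j, t)) 0 :=
      ContinuousAt.comp (f := fun t : ℝ => ((j, t) : ExtJet))
        (h.smooth_arb.contDiffAt ((h.isOpen_domain hU hW).mem_nhds hm)).continuousAt
        (by fun_prop)
    have h1 : Tendsto (fun t : ℝ => φ.arb (j, t)) (𝓝[≠] 0) (𝓝 (φ.arb (j, 0))) :=
      hcont.tendsto.mono_left nhdsWithin_le_nhds
    have h2 : Tendsto (fun t : ℝ => τ * (a / τ) ^ 2 * t) (𝓝[≠] 0) (𝓝 (τ * (a / τ) ^ 2 * 0)) :=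
      (by fun_prop : Continuous fun t : ℝ => τ * (a / τ) ^ 2 * t).continuousAt.tendsto.mono_left
        nhdsWithin_le_nhds
    refine tendsto_nhds_unique h1 (h2.congr' ?_)
    filter_upwards [nhdsWithin_le_nhds (hW.mem_nhds hm.1.2), self_mem_nhdsWithin] with t ht ht0
    exact (harb (j, t) ⟨⟨hm.1.1, ht⟩, hm.2⟩ ht0).symm

end IsEquivalenceTransformation

/-! ### The equivalence algebra -/

/-- Two points differing by δ ≠ 0 in every coordinate suffice to separate scalings from shifts
below. -/
theorem exists_add_const_mem {V : Set Base} (hV : IsOpen V) {z : Base} (hz : z ∈ V) :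
    ∃ δ : ℝ, δ ≠ 0 ∧ (fun i => z i + δ) ∈ V := by
  have hc : ContinuousAt (fun (δ : ℝ) (i : Fin 4) => z i + δ) 0 := by fun_prop
  have h1 : ∀ᶠ δ : ℝ in 𝓝[≠] 0, (fun i => z i + δ) ∈ V :=
    nhdsWithin_le_nhds (hc.eventually (hV.mem_nhds (by simpa using hz)))
  obtain ⟨δ, h2, h3⟩ := (h1.and self_mem_nhdsWithin).exists
  exact ⟨δ, h3, h2⟩

theorem field_injective_on_base {V : Set Base} (hV : IsOpen V) (hne : V.Nonempty)
    {c c' : Fin 5 → ℝ} (h : ∀ z ∈ V, (field c (z, 0)).1 = (field c' (z, 0)).1) : c = c' := by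
  obtain ⟨z, hz⟩ := hne
  obtain ⟨δ, hδ, hz'⟩ := exists_add_const_mem hV hz
  have e := fun i => congrFun (h z hz) i
  have e' := fun i => congrFun (h _ hz') i
  have a0 := e 0
  have a1 := e 1
  have a2 := e 2
  have b0 := e' 0
  have b2 := e' 2
  simp [field] at a0 a1 a2 b0 b2
  have h3 : c 3 = c' 3 := mul_left_cancel₀ hδ (by linear_combination b0 - a0)
  have h4 : c 4 = c' 4 := mul_left_cancel₀ hδ (by linear_combination b2 - a2 + δ * h3)
  have h0 : c 0 = c' 0 := by rw [h3] at a0; linarith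
  have h2 : c 2 = c' 2 := by rw [h3, h4] at a2; linarith
  have h1 : c 1 = c' 1 := by rw [h2, h4] at a1; linarith
  funext i
  fin_cases i <;> assumption

/-- The derivative of a curve of similarities through the identity is a combination of the basis
fields. -/
theorem exists_hasDerivAt_similarity {τ b k t₀ x₀ : ℝ → ℝ} {V : Set Base} (hV : IsOpen V)
    (hne : V.Nonempty) {c : ℝ}
    (hd : ∀ z ∈ V, DifferentiableAt ℝ
      (fun r => similarity (τ r) (b r) (k r) (t₀ r) (x₀ r) (z, c)) 0)
    (h0 : ∀ z ∈ V, similarity (τ 0) (b 0) (k 0) (t₀ 0) (x₀ 0) (z, c) = (z, c)) :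
    ∃ v, ∀ y, HasDerivAt (fun r => similarity (τ r) (b r) (k r) (t₀ r) (x₀ r) y) (field v y) 0 := by
  obtain ⟨z, hz⟩ := hne
  obtain ⟨δ, hδ, hz'⟩ := exists_add_const_mem hV hz
  have d := fun i => differentiableAt_pi.1 (hd z hz).fst i
  have d' := fun i => differentiableAt_pi.1 (hd _ hz').fst i
  have d0 : DifferentiableAt ℝ (fun r => τ r * z 0 + t₀ r) 0 := d 0
  have d1 : DifferentiableAt ℝ (fun r => τ r * b r * z 1 + τ r * k r * z 0 + x₀ r) 0 := d 1
  have d2 : DifferentiableAt ℝ (fun r => b r * z 2 + k r) 0 := d 2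
  have d0' : DifferentiableAt ℝ (fun r => τ r * (z 0 + δ) + t₀ r) 0 := d' 0
  have d2' : DifferentiableAt ℝ (fun r => b r * (z 2 + δ) + k r) 0 := d' 2
  -- No regularity of the parameters in r is assumed: scalings are difference quotients of
  -- components at the two points, and the shifts follow by subtraction.
  have hτ : DifferentiableAt ℝ τ 0 := by
    have h1 : τ = fun r => (τ r * (z 0 + δ) + t₀ r - (τ r * z 0 + t₀ r)) / δ := by
      funext r
      field_simp
      ring
    rw [h1]
    exact (d0'.fun_sub d0).div_const δ
  have hb : DifferentiableAt ℝ b 0 := by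
    have h1 : b = fun r => (b r * (z 2 + δ) + k r - (b r * z 2 + k r)) / δ := by
      funext r
      field_simp
      ring
    rw [h1]
    exact (d2'.fun_sub d2).div_const δ
  have ht₀ : DifferentiableAt ℝ t₀ 0 := by
    have h1 : t₀ = fun r => τ r * z 0 + t₀ r - τ r * z 0 := by
      funext r
      ring
    rw [h1]
    exact d0.fun_sub (hτ.mul_const (z 0))
  have hk : DifferentiableAt ℝ k 0 := by
    have h1 : k = fun r => b r * z 2 + k r - b r * z 2 := by
      funext r
      ring
    rw [h1]
    exact d2.fun_sub (hb.mul_const (z 2))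
  have hx₀ : DifferentiableAt ℝ x₀ 0 := by
    have h1 : x₀ = fun r => τ r * b r * z 1 + τ r * k r * z 0 + x₀ r -
        (τ r * b r * z 1 + τ r * k r * z 0) := by
      funext r
      ring
    rw [h1]
    exact d1.fun_sub (((hτ.fun_mul hb).mul_const (z 1)).fun_add
      ((hτ.fun_mul hk).mul_const (z 0)))
  have e := fun i => congrFun (congrArg Prod.fst (h0 z hz)) i
  have e' := fun i => congrFun (congrArg Prod.fst (h0 _ hz')) i
  have e0 : τ 0 * z 0 + t₀ 0 = z 0 := e 0
  have e1 : τ 0 * b 0 * z 1 + τ 0 * k 0 * z 0 + x₀ 0 = z 1 := e 1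
  have e2 : b 0 * z 2 + k 0 = z 2 := e 2
  have e0' : τ 0 * (z 0 + δ) + t₀ 0 = z 0 + δ := e' 0
  have e2' : b 0 * (z 2 + δ) + k 0 = z 2 + δ := e' 2
  have τ0 : τ 0 = 1 := mul_left_cancel₀ hδ (by linear_combination e0' - e0)
  have b0 : b 0 = 1 := mul_left_cancel₀ hδ (by linear_combination e2' - e2)
  have k0 : k 0 = 0 := by rw [b0] at e2; linarith
  refine ⟨![deriv t₀ 0, deriv x₀ 0, deriv k 0, deriv τ 0, deriv τ 0 + deriv b 0], fun y => ?_⟩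
  have Hτ := hτ.hasDerivAt
  have Hb := hb.hasDerivAt
  have Hk := hk.hasDerivAt
  refine HasDerivAt.prodMk (hasDerivAt_pi.2 fun i => ?_) ?_
  · fin_cases i
    · refine ((Hτ.mul_const (y.1 0)).add ht₀.hasDerivAt).congr_deriv ?_
      simp; ring
    · refine ((((Hτ.mul Hb).mul_const (y.1 1)).add ((Hτ.mul Hk).mul_const (y.1 0))).add
        hx₀.hasDerivAt).congr_deriv ?_
      simp [τ0, b0, k0]; ring
    · refine ((Hb.mul_const (y.1 2)).add Hk).congr_deriv ?_
      simp; ring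
    · refine ((Hb.pow 2).mul_const (y.1 3)).congr_deriv ?_
      simp [b0]
  · refine ((Hτ.mul (Hb.pow 2)).mul_const y.2).congr_deriv ?_
    simp [τ0, b0]
    left
    ring

theorem similarityJet_one (j : Jet) : similarityJet 1 1 0 0 0 j = j := by
  funext i
  fin_cases i <;> simp [similarityJet]

theorem toBase_prolong (g : Base → Base) (j : Jet) : toBase (prolong g j) = g (toBase j) := by
  funext i
  fin_cases i <;> rfl

theorem jac_eq_of_eqOn_similarityBase {g : Base → Base} {V : Set Base} (hV : IsOpen V)
    {τ b k t₀ x₀ : ℝ} (h : ∀ z ∈ V, g z = similarityBase τ b k t₀ x₀ z) {j : Jet}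
    (hj : toBase j ∈ V) : jac g j = τ ^ 2 * b := by
  have : g =ᶠ[𝓝 (toBase j)] similarityBase τ b k t₀ x₀ := by
    filter_upwards [hV.mem_nhds hj] with z hz using h z hz
  rw [(jac_congr this).eq_of_nhds, jac_similarityBase]

namespace IsInfinitesimalEquivalence

variable {S : Set ArbElem} {U : Set Base} {W : Set ℝ} {Q : ExtJet → Total}

/-- Each nearby map of the one-parameter group is a similarity, and the velocity of this curve at
the identity is a combination of the basis fields. One slice F = c is enough, since projectability
relates different slices afterwards. -/
theorem exists_local_eq (h : IsInfinitesimalEquivalence S U W Q)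
    (hS : S = allElements ∨ S = nonvanishingElements) {z : Base} (hz : z ∈ U) {c : ℝ}
    (hc : c ∈ W) : ∃ v V, IsOpen V ∧ z ∈ V ∧ ∀ m : ExtJet, toBase m.1 ∈ V → m.2 = c →
      Q m = field v (toTotal m) := by
  obtain ⟨U₁, -, W₁, -, ε, hε, φ, hU₁, hU₁c, hz₁, hW₁, hc₁, hφ, -, -, hb0, ha0, hflow⟩ :=
    h.generates z hz c hc
  -- Dummy zeros for |s| ≥ ε make the chosen parameters functions on all of ℝ; only s near 0
  -- matters.
  have hpar : ∀ s, ∃ τ b k t₀ x₀ : ℝ, |s| < ε → τ ≠ 0 ∧ b ≠ 0 ∧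
      (∀ z ∈ U₁, (φ s).base z = similarityBase τ b k t₀ x₀ z) ∧
      ∀ m ∈ (φ s).domain U₁ W₁, (φ s).arb m = τ * b ^ 2 * m.2 := fun s => by
    by_cases hs : |s| < ε
    · obtain ⟨τ, b, k, t₀, x₀, hp⟩ := (hφ s hs).exists_similarity hS hU₁ hU₁c hW₁ ⟨c, hc₁⟩
      exact ⟨τ, b, k, t₀, x₀, fun _ => hp⟩
    · exact ⟨0, 0, 0, 0, 0, fun hs' => absurd hs' hs⟩
  choose τ b k t₀ x₀ hp using hpar
  have h00 : |(0 : ℝ)| < ε := by simpa using hε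
  have hdom : ∀ s, |s| < ε → ∀ m ∈ cylinder U₁ W₁, m ∈ (φ s).domain U₁ W₁ := fun s hs m hm => by
    obtain ⟨hτ, hb, hbase, -⟩ := hp s hs
    refine ⟨hm, ?_⟩
    rw [jac_eq_of_eqOn_similarityBase hU₁ hbase hm.1]
    positivity
  have heq : ∀ s, |s| < ε → ∀ m ∈ cylinder U₁ W₁,
      (((φ s).base (toBase m.1), (φ s).arb m) : Total) =
        similarity (τ s) (b s) (k s) (t₀ s) (x₀ s) (toTotal m) := fun s hs m hm => by
    obtain ⟨-, -, hbase, harb⟩ := hp s hs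
    rw [hbase _ hm.1, harb m (hdom s hs m hm)]
    rfl
  have hact : ∀ m ∈ cylinder U₁ W₁, (φ 0).act m = m := fun m hm => by
    have hg : (φ 0).base =ᶠ[𝓝 (toBase m.1)] similarityBase 1 1 0 0 0 := by
      filter_upwards [hU₁.mem_nhds hm.1] with z' hz'
      rw [hb0 z' hz']
      exact (congrArg Prod.fst (similarity_one (z', 0))).symm
    rw [Transf.act, prolong_congr hg, prolong_similarityBase one_ne_zero one_ne_zero,
      similarityJet_one, ha0 m hm]
  have hder : ∀ m ∈ cylinder U₁ W₁, HasDerivAt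
      (fun r => similarity (τ r) (b r) (k r) (t₀ r) (x₀ r) (toTotal m)) (Q m) 0 := fun m hm => by
    have h1 := (hflow 0 h00 m (hdom 0 h00 m hm)).2
    rw [hact m hm] at h1
    refine h1.congr_of_eventuallyEq ?_
    filter_upwards [Metric.ball_mem_nhds (0 : ℝ) hε] with r hr
    exact (heq r (by simpa using hr) m hm).symm
  have hlift : ∀ z' : Base, toTotal (jet z' 0 0 0 0 0 0, c) = (z', c) := fun z' => by
    rw [toTotal, toBase_jet]
  have hmem : ∀ z' ∈ U₁, ((jet z' 0 0 0 0 0 0, c) : ExtJet) ∈ cylinder U₁ W₁ := fun z' hz' =>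
    ⟨by rwa [toBase_jet], hc₁⟩
  obtain ⟨v, hv⟩ := exists_hasDerivAt_similarity (τ := τ) (b := b) (k := k) (t₀ := t₀) (x₀ := x₀)
    hU₁ ⟨z, hz₁⟩ (c := c)
    (fun z' hz' => hlift z' ▸ (hder _ (hmem z' hz')).differentiableAt) fun z' hz' => by
      rw [← hlift z', ← heq 0 h00 _ (hmem z' hz'), ha0 _ (hmem z' hz'), hlift, toBase_jet,
        hb0 z' hz']
  exact ⟨v, U₁, hU₁, hz₁, fun m hm hmc => (hder m ⟨hm, hmc ▸ hc₁⟩).unique (hv _)⟩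

/-- The base components on any nonempty open set determine the coefficients, and by projectability
these components are independent of F. So the local coefficients agree between slices, whether or
not `W` is connected, and are locally constant in the point; connectedness of `U` makes them
constant. -/
theorem exists_eq_field (h : IsInfinitesimalEquivalence S U W Q)
    (hS : S = allElements ∨ S = nonvanishingElements) (hU : IsOpen U) (hUc : IsConnected U)
    (hne : W.Nonempty) : ∃ v, ∀ m ∈ cylinder U W, Q m = field v (toTotal m) := by
  obtain ⟨Q₀, hQ₀⟩ := h.projectable
  have hloc : ∀ z c, ∃ v V, z ∈ U → c ∈ W → IsOpen V ∧ z ∈ V ∧ V ⊆ U ∧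
      ∀ m : ExtJet, toBase m.1 ∈ V → m.2 = c → Q m = field v (toTotal m) := fun z c => by
    by_cases hzc : z ∈ U ∧ c ∈ W
    · obtain ⟨v, V, hV, hz, hv⟩ := h.exists_local_eq hS hzc.1 hzc.2
      exact ⟨v, V ∩ U, fun _ _ => ⟨hV.inter hU, ⟨hz, hzc.1⟩, Set.inter_subset_right,
        fun m hm => hv m hm.1⟩⟩
    · exact ⟨0, ∅, fun hz hc => absurd ⟨hz, hc⟩ hzc⟩
  choose v V hv using hloc
  have hbase : ∀ z ∈ U, ∀ c ∈ W, ∀ z' ∈ V z c, Q₀ z' = (field (v z c) (z', 0)).1 := by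
    intro z hz c hc z' hz'
    obtain ⟨-, -, hVU, hQ⟩ := hv z c hz hc
    have h1 := hQ₀ (jet z' 0 0 0 0 0 0, c) ⟨by rw [toBase_jet]; exact hVU hz', hc⟩
    rw [hQ _ (by rwa [toBase_jet]) rfl, toTotal, toBase_jet] at h1
    exact h1.symm
  have huniq : ∀ z ∈ U, ∀ c ∈ W, ∀ z' ∈ U, ∀ c' ∈ W, z' ∈ V z c → v z' c' = v z c := by
    intro z hz c hc z' hz' c' hc' hmem
    obtain ⟨hV, -, -, -⟩ := hv z c hz hc
    obtain ⟨hV', hzV', -, -⟩ := hv z' c' hz' hc'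
    refine field_injective_on_base (hV.inter hV') ⟨z', hmem, hzV'⟩ fun y hy => ?_
    rw [← hbase z hz c hc y hy.1, ← hbase z' hz' c' hc' y hy.2]
  obtain ⟨c₀, hc₀⟩ := hne
  have hconst : ∀ i, ∃ a, ∀ z ∈ U, v z c₀ i = a := fun i =>
    exists_const_of_pd_eq_zero hU hUc fun z hz k => by
      obtain ⟨hV, hzV, hVU, -⟩ := hv z c₀ hz hc₀
      have hev : (fun z => v z c₀ i) =ᶠ[𝓝 z] fun _ => v z c₀ i := by
        filter_upwards [hV.mem_nhds hzV] with z' hz'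
        rw [huniq z hz c₀ hc₀ z' (hVU hz') c₀ hc₀ hz']
      have := HasPD.const k (v z c₀ i) z
      exact ⟨this.1.congr_of_eventuallyEq hev, by rw [pd, hev.fderiv_eq]; exact this.2⟩
  choose a ha using hconst
  refine ⟨a, fun m hm => ?_⟩
  obtain ⟨-, hzV, -, hQ⟩ := hv _ m.2 hm.1 hm.2
  rw [hQ m hzV rfl, huniq _ hm.1 c₀ hc₀ _ hm.1 m.2 hm.2 (hv _ c₀ hm.1 hc₀).2.1]
  congr 1
  funext i
  exact ha i _ hm.1

end IsInfinitesimalEquivalence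

/-! ### Fields in the span generate equivalence transformations -/

theorem contDiff_toTotal : ContDiff ℝ ∞ toTotal :=
  (contDiff_pi.2 fun i => by fin_cases i <;> simp [toBase] <;> fun_prop).prodMk contDiff_snd

theorem contDiff_field (c : Fin 5 → ℝ) : ContDiff ℝ ∞ (field c) :=
  (contDiff_pi.2 fun i => by fin_cases i <;> simp <;> fun_prop).prodMk (by fun_prop)

theorem contDiff_flow (c : Fin 5 → ℝ) : ContDiff ℝ ∞ fun p : ℝ × Total => flow c p.1 p.2 := by
  have hK := (contDiff_flowK c).comp (contDiff_fst (𝕜 := ℝ) (E := ℝ) (F := Total))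
  have hT := (contDiff_flowT c).comp (contDiff_fst (𝕜 := ℝ) (E := ℝ) (F := Total))
  have hX := (contDiff_flowX c).comp (contDiff_fst (𝕜 := ℝ) (E := ℝ) (F := Total))
  simp only [Function.comp_def] at hK hT hX
  refine (contDiff_pi.2 fun i => ?_).prodMk (by fun_prop)
  fin_cases i <;> simp <;> fun_prop

theorem isInfinitesimalEquivalence_of_eq_field {S : Set ArbElem}
    (hS : S = allElements ∨ S = nonvanishingElements) {U : Set Base} {W : Set ℝ} (hU : IsOpen U)
    (hW : IsOpen W) {Q : ExtJet → Total} {v : Fin 5 → ℝ}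
    (hQ : ∀ m ∈ cylinder U W, Q m = field v (toTotal m)) :
    IsInfinitesimalEquivalence S U W Q := by
  refine ⟨((contDiff_field v).comp contDiff_toTotal).contDiffOn.congr hQ,
    ⟨fun z => (field v (z, 0)).1, fun m hm => by rw [hQ m hm]; rfl⟩, fun z hz c hc => ?_⟩
  let φ : ℝ → Transf := fun s =>
    { base := fun z => (flow v s (z, 0)).1
      arb := fun m => (flow v s (toTotal m)).2 }
  have hopen : IsOpen ((fun p : ℝ × Total => flow v p.1 p.2) ⁻¹' (U ×ˢ W)) :=
    (hU.prod hW).preimage (contDiff_flow v).continuous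
  -- By joint continuity, one ε bounds both the time and the balls so that the flow stays inside `U`
  -- and `W`.
  obtain ⟨ε, hε, hball⟩ := Metric.isOpen_iff.1 hopen (0, (z, c)) (by
    rw [Set.mem_preimage, flow_zero]
    exact ⟨hz, hc⟩)
  have hmem : ∀ s, |s| < ε → ∀ z' ∈ Metric.ball z ε, ∀ c' ∈ Metric.ball c ε,
      flow v s (z', c') ∈ U ×ˢ W := fun s hs z' hz' c' hc' =>
    @hball (s, (z', c')) (by
      rw [Metric.mem_ball, Prod.dist_eq, Prod.dist_eq]
      exact max_lt (by simpa using hs) (max_lt hz' hc'))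
  have h00 : |(0 : ℝ)| < ε := by simpa using hε
  have hact : ∀ s m, toTotal ((φ s).act m) = flow v s (toTotal m) := fun s m => by
    rw [Transf.act, toTotal, toBase_prolong]
    rfl
  refine ⟨Metric.ball z ε, fun z' hz' => ?_, Metric.ball c ε, fun c' hc' => ?_, ε, hε, φ,
    Metric.isOpen_ball, ⟨⟨z, Metric.mem_ball_self hε⟩, (convex_ball z ε).isPreconnected⟩,
    Metric.mem_ball_self hε, Metric.isOpen_ball, Metric.mem_ball_self hε, fun s hs => ?_,
    ?_, ?_, fun z' _ => ?_, fun m _ => ?_, fun s hs m hm => ⟨?_, ?_⟩⟩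
  · have := hmem 0 h00 z' hz' c (Metric.mem_ball_self hε)
    rw [flow_zero] at this
    exact this.1
  · have := hmem 0 h00 z (Metric.mem_ball_self hε) c' hc'
    rw [flow_zero] at this
    exact this.2
  · exact isEquivalenceTransformation_of_similarity hS Metric.isOpen_ball Metric.isOpen_ball
      (Real.exp_ne_zero (v 3 * s)) (Real.exp_ne_zero ((v 4 - v 3) * s)) (flowK v s) (flowT v s)
      (flowX v s) (fun _ _ => rfl) (fun _ _ => rfl)
  · exact ((contDiff_flow v).comp (contDiff_fst.prodMk
      (contDiff_snd.prodMk contDiff_const))).fst.contDiffOn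
  · exact ((contDiff_flow v).comp (contDiff_fst.prodMk
      (contDiff_toTotal.comp contDiff_snd))).snd.contDiffOn
  · exact congrArg Prod.fst (flow_zero v (z', 0))
  · exact congrArg Prod.snd (flow_zero v (toTotal m))
  · have h1 := hmem s hs _ hm.1.1 _ hm.1.2
    rw [← show toTotal m = (toBase m.1, m.2) from rfl, ← hact] at h1
    exact h1
  · have h1 := hmem s hs _ hm.1.1 _ hm.1.2
    rw [← show toTotal m = (toBase m.1, m.2) from rfl, ← hact] at h1
    rw [hQ _ h1, hact]
    exact hasDerivAt_flow v (toTotal m) s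

/-! ### The equivalence group -/

theorem isEquivalenceTransformation_iff {S : Set ArbElem}
    (hS : S = allElements ∨ S = nonvanishingElements) {U : Set Base} {W : Set ℝ} (hU : IsOpen U)
    (hUc : IsConnected U) (hW : IsOpen W) (hne : W.Nonempty) (φ : Transf) :
    IsEquivalenceTransformation S U W φ ↔ ∃ σ ∈ generatedGroup,
      (∀ z ∈ U, ∀ c ∈ W, φ.base z = (σ (z, c)).1) ∧
      ∀ m ∈ φ.domain U W, φ.arb m = (σ (toTotal m)).2 := by
  rw [generatedGroup_eq]
  constructor
  · intro h
    obtain ⟨τ, b, k, t₀, x₀, hτ, hb, hbase, harb⟩ := h.exists_similarity hS hU hUc hW hne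
    exact ⟨similarityPerm hτ hb k t₀ x₀, ⟨Units.mk0 τ hτ, trivial, Units.mk0 b hb, trivial, k, t₀,
      x₀, fun _ => rfl⟩, fun z hz _ _ => hbase z hz, harb⟩
  · rintro ⟨σ, ⟨τ, -, b, -, k, t₀, x₀, hσ⟩, hbase, harb⟩
    obtain ⟨c, hc⟩ := hne
    refine isEquivalenceTransformation_of_similarity hS hU hW τ.ne_zero b.ne_zero k t₀ x₀
      (fun z hz => ?_) fun m hm => ?_
    · rw [hbase z hz c hc, hσ]
      rfl
    · rw [harb m hm, hσ]
      rfl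

end ShallowWater

end

theorem mainTheorem2 (S : Set ShallowWater.ArbElem)
    (hS : S = ShallowWater.allElements ∨ S = ShallowWater.nonvanishingElements) :
    LinearIndependent ℝ ShallowWater.basisField ∧
    (ShallowWater.discrete₁ ∉ ShallowWater.continuousGroup ∧
      ShallowWater.discrete₂ ∉ ShallowWater.continuousGroup ∧
      ShallowWater.discrete₁ * ShallowWater.discrete₂ ∉ ShallowWater.continuousGroup) ∧
    ∀ (U : Set ShallowWater.Base) (W : Set ℝ), IsOpen U → IsConnected U →
      IsOpen W → W.Nonempty →
      (∀ Q : ShallowWater.ExtJet → ShallowWater.Total,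
        ShallowWater.IsInfinitesimalEquivalence S U W Q ↔
          ∃ v ∈ ShallowWater.fieldSpan, ∀ m ∈ ShallowWater.cylinder U W,
            Q m = v (ShallowWater.toTotal m)) ∧
      (∀ φ : ShallowWater.Transf,
        ShallowWater.IsEquivalenceTransformation S U W φ ↔
          ∃ σ ∈ ShallowWater.generatedGroup,
            (∀ z ∈ U, ∀ c ∈ W, φ.base z = (σ (z, c)).1) ∧
            ∀ m ∈ φ.domain U W, φ.arb m = (σ (ShallowWater.toTotal m)).2) := by
  refine ⟨ShallowWater.linearIndependent_basisField, ⟨ShallowWater.discrete₁_notMem,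
    ShallowWater.discrete₂_notMem, ShallowWater.discrete₁_mul_discrete₂_notMem⟩,
    fun U W hU hUc hW hne => ⟨fun Q => ⟨fun h => ?_, ?_⟩,
      ShallowWater.isEquivalenceTransformation_iff hS hU hUc hW hne⟩⟩
  · obtain ⟨v, hv⟩ := h.exists_eq_field hS hU hUc hne
    exact ⟨_, ShallowWater.mem_fieldSpan_iff.2 ⟨v, rfl⟩, hv⟩
  · rintro ⟨w, hw, hQ⟩
    obtain ⟨v, rfl⟩ := ShallowWater.mem_fieldSpan_iff.1 hw
    exact ShallowWater.isInfinitesimalEquivalence_of_eq_field hS hU hW hQ
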